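/- Let $G$ be a finite connected planar embedded multigraph, let $G^*$ be its planar dual with a chosen infinite face, and let the edges of $G^*$ have weights in $[0,\infty]$. Let $T^*$ be a shortest-path tree of $G^*$ with some root, all of whose edges have finite weight, and let $e$ be an edge of $G^*$ that is not in $T^*$. Suppose that the fundamental cycle of $e$ in $T^*$ is $S^* = P^*_a\, e\, P^*_b$, where $P^*_a$ and $P^*_b$ are the tree paths that descend to the two endpoints of $e$ from the vertex of $S^*$ closest to the root in $T^*$, and $P^*_b$ has at least one edge. Let $v^*_e$ be a face of $G^*$ incident to $e$, and let $v^*$ be a face of $G^*$ that is not enclosed by $S^*$ and is incident to the parentmost edge of $P^*_b$ (the one closest to the root). Then for every simple cycle $C^*$ of $G^*$ whose interior contains both $v^*$ and $v^*_e$ there is a simple cycle of $G^*$ that does not cross $S^*$ and whose length is at most the length of $C^*$. Here the interior of a simple cycle is the set of faces that it separates from the infinite face, and a simple cycle crosses $S^*$ if it is contained neither in $\mathrm{int}(S^*)$, the subgraph formed by the boundaries of the faces enclosed by $S^*$, nor in $\mathrm{ext}(S^*)$, the subgraph formed by the boundaries of the faces not enclosed by $S^*$. (Loops and pairs of parallel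 edges count as simple cycles.) -/

import Mathlib

open scoped ENNReal

/-- The darts of a graph with edge set `E`: every edge carries two opposite darts. -/
abbrev Dart (E : Type*) : Type _ := E × Bool

/-- The oppositely directed dart of the same edge. -/
def Dart.reverse {E : Type*} (d : Dart E) : Dart E := (d.1, !d.2)

/-- `Dart.reverse` as a permutation of the darts. -/
def Dart.reversePerm (E : Type*) : Equiv.Perm (Dart E) where
  toFun := Dart.reverse
  invFun := Dart.reverse
  left_inv d := by simp [Dart.reverse]
  right_inv d := by simp [Dart.reverse]

/-- A combinatorial embedding (rotation system) of a multigraph with edge set `E`, on a closed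
oriented surface. `rot d` is the dart that follows `d` in counterclockwise order among the darts
with the same tail as `d`. Loops and parallel edges are allowed. -/
structure EmbeddedGraph (E : Type*) where
  rot : Equiv.Perm (Dart E)

namespace EmbeddedGraph

variable {E : Type*}

/-- The successor of a dart on the counterclockwise boundary walk of the face to its left. -/
def faceNext (G : EmbeddedGraph E) : Equiv.Perm (Dart E) := G.rot⁻¹ * Dart.reversePerm E

/-- Vertices are the cycles of the rotation. -/
def Vertex (G : EmbeddedGraph E) : Type _ := Quotient (Equiv.Perm.SameCycle.setoid G.rot)

/-- Faces are the cycles of the boundary-walk permutation. -/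
def Face (G : EmbeddedGraph E) : Type _ := Quotient (Equiv.Perm.SameCycle.setoid G.faceNext)

def tail (G : EmbeddedGraph E) (d : Dart E) : G.Vertex := Quotient.mk _ d

def head (G : EmbeddedGraph E) (d : Dart E) : G.Vertex := G.tail d.reverse

/-- The face to the left of a dart. -/
def left (G : EmbeddedGraph E) (d : Dart E) : G.Face := Quotient.mk _ d

/-- The face to the right of a dart. -/
def right (G : EmbeddedGraph E) (d : Dart E) : G.Face := G.left d.reverse

/-- A face is incident to an edge if it lies to the left or to the right of it. -/
def Incident (G : EmbeddedGraph E) (f : G.Face) (x : E) : Prop :=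
  G.left (x, true) = f ∨ G.right (x, true) = f

/-- The dual embedded graph, on the same edges: the dual of a dart `d` points from the face to
the left of `d` to the face to the right of `d`, so the dual vertices are the faces of `G`, and
the face to the left of the dual of `d` corresponds to the head of `d`. -/
def dual (G : EmbeddedGraph E) : EmbeddedGraph E where
  rot := G.faceNext

/-- `G.IsWalk u v l`: the darts in `l`, one after the other, form a walk from `u` to `v`. -/
def IsWalk (G : EmbeddedGraph E) (u v : G.Vertex) : List (Dart E) → Prop
  | [] => u = v
  | d :: l => G.tail d = u ∧ G.IsWalk (G.head d) v l

/-- A path is a walk that visits no vertex twice. -/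
def IsPath (G : EmbeddedGraph E) (u v : G.Vertex) (l : List (Dart E)) : Prop :=
  G.IsWalk u v l ∧ (u :: l.map G.head).Nodup

/-- A simple cycle, given by its darts in cyclic order: a nonempty closed walk that repeats
neither a vertex nor an edge (a loop is a cycle with one edge, two parallel edges form a cycle
with two edges). -/
def IsCycle (G : EmbeddedGraph E) (l : List (Dart E)) : Prop :=
  l ≠ [] ∧ (∃ u, G.IsWalk u u l) ∧ (l.map G.tail).Nodup ∧ (l.map Prod.fst).Nodup

/-- The same walk traversed backwards. -/
def reverseWalk (l : List (Dart E)) : List (Dart E) := (l.map Dart.reverse).reverse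

/-- The set of edges of a walk. -/
def edges (l : List (Dart E)) : Set E := {x | ∃ d ∈ l, d.1 = x}

/-- The length of a walk with respect to edge weights. -/
noncomputable def length (w : E → ℝ≥0∞) (l : List (Dart E)) : ℝ≥0∞ := (l.map fun d => w d.1).sum

def Connected (G : EmbeddedGraph E) : Prop := ∀ u v : G.Vertex, ∃ l, G.IsWalk u v l

/-- A connected graph embedded in the sphere: its genus, by Euler's formula, is zero. -/
def IsPlanar (G : EmbeddedGraph E) : Prop :=
  G.Connected ∧ Nat.card G.Vertex + Nat.card G.Face = Nat.card E + 2

/-- The edges in `T` form a spanning tree: `T` connects all vertices and contains no cycle. -/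
def IsSpanningTree (G : EmbeddedGraph E) (T : Set E) : Prop :=
  (∀ u v : G.Vertex, ∃ l, G.IsWalk u v l ∧ edges l ⊆ T) ∧ ∀ l, G.IsCycle l → ¬ edges l ⊆ T

/-- A shortest-path tree with root `r`: a spanning tree whose edges have finite weight, and
whose path from `r` to any vertex `v` is a shortest walk of the graph from `r` to `v`. -/
def IsShortestPathTree (G : EmbeddedGraph E) (w : E → ℝ≥0∞) (r : G.Vertex) (T : Set E) : Prop :=
  G.IsSpanningTree T ∧ (∀ x ∈ T, w x ≠ ⊤) ∧
    ∀ (v : G.Vertex) (p q : List (Dart E)),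
      G.IsPath r v p → edges p ⊆ T → G.IsWalk r v q → length w p ≤ length w q

/-- The cycle that runs along `Pa`, then along the dart `d`, and then back along `Pb`. -/
def separator (Pa : List (Dart E)) (d : Dart E) (Pb : List (Dart E)) : List (Dart E) :=
  Pa ++ d :: reverseWalk Pb

/-- `Pa`, the edge of `d`, and `Pb` form the fundamental cycle of the non-tree edge of `d` in the
tree `T` with root `r`: `P₀` is the tree path from the root to the parentmost vertex of the
cycle, and `Pa`, `Pb` are the tree paths that descend from there to the tail and to the head
of `d`. -/
structure IsTreeSeparator (G : EmbeddedGraph E) (r : G.Vertex) (T : Set E)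
    (Pa : List (Dart E)) (d : Dart E) (Pb : List (Dart E)) : Prop where
  nontree : d.1 ∉ T
  descending : ∃ P₀ : List (Dart E),
    (G.IsPath r (G.tail d) (P₀ ++ Pa) ∧ edges (P₀ ++ Pa) ⊆ T) ∧
    (G.IsPath r (G.head d) (P₀ ++ Pb) ∧ edges (P₀ ++ Pb) ⊆ T)
  cycle : G.IsCycle (separator Pa d Pb)

/-- Two faces share an edge that is not in `C`. -/
def FaceStep (G : EmbeddedGraph E) (C : Set E) (f g : G.Face) : Prop :=
  ∃ d : Dart E, d.1 ∉ C ∧ G.left d = f ∧ G.right d = g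

/-- The faces in the interior of a cycle with edge set `C`, where `o` is the infinite face: those
that cannot be reached from `o` without crossing an edge of `C`. -/
def interior (G : EmbeddedGraph E) (o : G.Face) (C : Set E) : Set G.Face :=
  {f | ¬ Relation.ReflTransGen (G.FaceStep C) o f}

/-- The edges of the subgraph induced by the faces enclosed by `C` (edges of `C` included). -/
def intEdges (G : EmbeddedGraph E) (o : G.Face) (C : Set E) : Set E :=
  {x | ∃ f, f ∈ G.interior o C ∧ G.Incident f x}

/-- The edges of the subgraph induced by the faces not enclosed by `C` (edges of `C` included). -/
def extEdges (G : EmbeddedGraph E) (o : G.Face) (C : Set E) : Set E :=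
  {x | ∃ f, f ∉ G.interior o C ∧ G.Incident f x}

/-- A cycle crosses the cycle `S` if it is contained neither in the closed interior of `S` nor in
the closed exterior of `S`. -/
def Crosses (G : EmbeddedGraph E) (o : G.Face) (C S : List (Dart E)) : Prop :=
  ¬ edges C ⊆ G.intEdges o (edges S) ∧ ¬ edges C ⊆ G.extEdges o (edges S)

end EmbeddedGraph

noncomputable section
namespace EmbeddedGraph

variable {E : Type*}

/-! Exchange argument. Cut `C` at the vertices of `S` into pieces whose inner vertices avoid `S`;
each piece runs along `S`, strictly inside it, or strictly outside it. Let `K` be the side of `S`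
containing `ve`, and suppose that no noncrossing cycle is as short as `C`. Then some piece lies in
`K`, since otherwise `C` would not cross. Closing a piece along a shortest path contained in `S`
costs at most the rest of `C`. This excludes a piece in `K` with both ends on one tree path
(`exists_of_same_path`), two pieces in opposite directions between the paths (`exists_of_opposite`),
and a visit of `C` to the common start `z` of the paths (`exists_of_apex`). The closed walks built
this way use some edge off `S` exactly once, so they contain a simple cycle.

There remains the case where all pieces in `K` run in the same direction between the paths and `C`
avoids `z`, hence also `b` (`false_of_same_direction`). Let `f` be the winding function of `C`, and
`g` the sum of the winding functions of the pieces in `K`, each closed along `S` through `z`. These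
closures all use `b` in the same direction and none uses `e`, so `g` jumps by a nonzero amount at
`b` and not at `e`. But `f - g` is constant on `K` and `g` is constant off `K`; since `f` agrees at
`v` and `ve`, both inside `C`, and does not jump at `b`, the jump of `g` at `b` must vanish.

Topology enters through linear algebra: Euler's formula makes closed walks bound
(`IsSphere.exists_potential`), and the Jordan curve theorem (`IsSphere.eq_of_mem_interior_iff`)
follows from orthogonality of the two coboundaries. -/

/-! ### Darts, their ends and their sides -/

theorem _root_.Dart.reverse_reverse (d : Dart E) : d.reverse.reverse = d := by
  simp [Dart.reverse]

theorem _root_.Dart.reverse_ne (d : Dart E) : d.reverse ≠ d := by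
  intro h
  have := congrArg Prod.snd h
  simp [Dart.reverse] at this

theorem _root_.Dart.eq_or_eq_reverse {d d' : Dart E} (h : d.1 = d'.1) : d = d' ∨ d = d'.reverse := by
  obtain ⟨x, s⟩ := d
  obtain ⟨y, t⟩ := d'
  simp only at h
  subst h
  cases s <;> cases t <;> simp [Dart.reverse]

theorem tail_rot (G : EmbeddedGraph E) (d : Dart E) : G.tail (G.rot d) = G.tail d :=
  Quotient.sound (Equiv.Perm.sameCycle_apply_left.2 (Equiv.Perm.SameCycle.refl _ _))

theorem left_faceNext (G : EmbeddedGraph E) (d : Dart E) : G.left (G.faceNext d) = G.left d :=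
  Quotient.sound (Equiv.Perm.sameCycle_apply_left.2 (Equiv.Perm.SameCycle.refl _ _))

theorem faceNext_reverse (G : EmbeddedGraph E) (d : Dart E) :
    G.faceNext d.reverse = G.rot⁻¹ d := by
  simp [faceNext, Dart.reversePerm, Dart.reverse_reverse]

theorem tail_faceNext (G : EmbeddedGraph E) (d : Dart E) : G.tail (G.faceNext d) = G.head d := by
  have := G.tail_rot (G.rot⁻¹ d.reverse)
  rw [← Equiv.Perm.mul_apply, mul_inv_cancel, Equiv.Perm.one_apply] at this
  rw [← Dart.reverse_reverse d, faceNext_reverse, ← this]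
  simp [head, Dart.reverse_reverse]

theorem right_rot (G : EmbeddedGraph E) (d : Dart E) : G.right (G.rot d) = G.left d := by
  rw [right, ← left_faceNext, faceNext_reverse, ← Equiv.Perm.mul_apply, inv_mul_cancel,
    Equiv.Perm.one_apply]

theorem head_reverse (G : EmbeddedGraph E) (d : Dart E) : G.head d.reverse = G.tail d := by
  simp [head, Dart.reverse_reverse]

theorem right_reverse (G : EmbeddedGraph E) (d : Dart E) : G.right d.reverse = G.left d := by
  simp [right, Dart.reverse_reverse]

/-! ### The sphere: every closed walk bounds -/

/-- The combinatorial sphere: the rotation and the reversal act transitively on the darts, and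
Euler's formula holds. -/
structure IsSphere (G : EmbeddedGraph E) : Prop where
  const : ∀ Φ : Dart E → ℝ, (∀ d, Φ (G.rot d) = Φ d) → (∀ d, Φ d.reverse = Φ d) →
    ∀ d d', Φ d = Φ d'
  euler : Nat.card G.Vertex + Nat.card G.Face = Nat.card E + 2

/-- The face permutation of the dual is conjugate to `G.rot` by reversal, so Euler's formula is
symmetric under duality. A function invariant under `faceNext` and reversal is also invariant under
`G.rot`, hence is carried unchanged along walks of the connected graph. -/
theorem IsPlanar.dual_isSphere {G : EmbeddedGraph E} (hG : G.IsPlanar) : G.dual.IsSphere where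
  const Φ h1 h2 := by
    have hr : ∀ d, Φ (G.rot d) = Φ d := by
      intro d
      have := h1 (G.rot d).reverse
      change Φ (G.faceNext _) = _ at this
      rw [faceNext_reverse, ← Equiv.Perm.mul_apply, inv_mul_cancel,
    Equiv.Perm.one_apply] at this
      rw [this, h2]
    have hs : ∀ d d', G.tail d = G.tail d' → Φ d = Φ d' := by
      intro d d' h
      obtain ⟨n, hn⟩ : G.rot.SameCycle d d' := Quotient.exact h
      have hz : ∀ n : ℤ, Φ ((G.rot ^ n) d) = Φ d := by
        intro n
        induction n with
        | zero => simp
        | succ n ih => rw [add_comm, zpow_add, Equiv.Perm.mul_apply, zpow_one, hr, ih]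
        | pred n ih =>
          rw [← ih, ← hr ((G.rot ^ (-(n : ℤ) - 1)) d), ← Equiv.Perm.mul_apply, ← zpow_one_add]
          congr 3
          ring
      rw [← hn, hz]
    have hw : ∀ l u v, G.IsWalk u v l → ∀ d d', G.tail d = u → G.tail d' = v → Φ d = Φ d' := by
      intro l
      induction l with
      | nil => intro u v h d d' hd hd'; exact hs _ _ (by rw [hd, hd', h])
      | cons a l ih =>
        intro u v h d d' hd hd'
        rw [hs d a (by rw [hd, h.1]), ← h2 a]
        exact ih _ _ h.2 _ _ rfl hd'
    intro d d'
    obtain ⟨l, hl⟩ := hG.1 (G.tail d) (G.tail d')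
    exact hw l _ _ hl _ _ rfl rfl
  euler := by
    have key : Nat.card G.dual.Face = Nat.card G.Vertex := by
      refine Nat.card_congr (Quotient.congr (Dart.reversePerm E) ?_)
      intro a c
      have hc : G.dual.faceNext = (Dart.reversePerm E)⁻¹ * G.rot * (Dart.reversePerm E)⁻¹⁻¹ := by
        simp only [EmbeddedGraph.faceNext, dual, mul_inv_rev, inv_inv]
      change G.dual.faceNext.SameCycle a c ↔ G.rot.SameCycle _ _
      rw [hc, Equiv.Perm.sameCycle_conj]
      simp
    rw [key, add_comm]
    exact hG.2

theorem IsSphere.face_const {G : EmbeddedGraph E} (hG : G.IsSphere) (f : G.Face → ℝ)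
    (h : ∀ d, f (G.left d) = f (G.right d)) (p q : G.Face) : f p = f q := by
  induction p using Quotient.inductionOn with | _ d =>
  induction q using Quotient.inductionOn with | _ d' =>
  refine hG.const (fun d => f (G.left d)) (fun d => ?_) (fun d => ?_) d d'
  · rw [h, right_rot]
  · rw [h d]; rfl

theorem IsSphere.vertex_const {G : EmbeddedGraph E} (hG : G.IsSphere) (f : G.Vertex → ℝ)
    (h : ∀ d, f (G.tail d) = f (G.head d)) (p q : G.Vertex) : f p = f q := by
  induction p using Quotient.inductionOn with | _ d =>
  induction q using Quotient.inductionOn with | _ d' =>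
  refine hG.const (fun d => f (G.tail d)) (fun d => ?_) (fun d => ?_) d d'
  · rw [tail_rot]
  · rw [h d]; rfl

/-- The sum over edges of a product of two antisymmetric dart functions, one of which is the
difference of the values at the two sides. -/
theorem orthogonality [Fintype E] (G : EmbeddedGraph E) (f : G.Face → ℝ) (h : G.Vertex → ℝ) :
    ∑ x : E, (f (G.left (x, true)) - f (G.right (x, true))) *
      (h (G.head (x, true)) - h (G.tail (x, true))) = 0 := by
  have h1 : ∑ d : Dart E, f (G.left d) * h (G.head d) = ∑ d : Dart E, f (G.left d) * h (G.tail d) := by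
    -- `faceNext` keeps the left face and moves the tail to the old head, so reindexing by it
    -- identifies the two sums.
    rw [← Equiv.sum_comp G.faceNext (fun d => f (G.left d) * h (G.tail d))]
    simp only [left_faceNext, tail_faceNext]
  rw [← sub_eq_zero, ← Finset.sum_sub_distrib, Fintype.sum_prod_type] at h1
  rw [← h1]
  refine Finset.sum_congr rfl fun x _ => ?_
  simp only [Fintype.sum_bool]
  have e1 : G.head (x, false) = G.tail (x, true) := rfl
  have e2 : G.tail (x, false) = G.head (x, true) := rfl
  have e3 : G.left (x, false) = G.right (x, true) := rfl
  rw [e1, e2, e3]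
  ring

/-- The coboundary of a function on the faces. -/
def faceDiff (G : EmbeddedGraph E) : (G.Face → ℝ) →ₗ[ℝ] EuclideanSpace ℝ E where
  toFun f := WithLp.toLp 2 fun x => f (G.left (x, true)) - f (G.right (x, true))
  map_add' f g := by ext x; simp; ring
  map_smul' c f := by ext x; simp; ring

/-- The coboundary of a function on the vertices. -/
def vertexDiff (G : EmbeddedGraph E) : (G.Vertex → ℝ) →ₗ[ℝ] EuclideanSpace ℝ E where
  toFun f := WithLp.toLp 2 fun x => f (G.head (x, true)) - f (G.tail (x, true))
  map_add' f g := by ext x; simp; ring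
  map_smul' c f := by ext x; simp; ring

theorem finrank_range_of_ker_const {α : Type*} [Finite α] [Nonempty α] {V : Type*}
    [AddCommGroup V] [Module ℝ V] [FiniteDimensional ℝ V] (D : (α → ℝ) →ₗ[ℝ] V)
    (h1 : D 1 = 0) (h : ∀ f, D f = 0 → ∀ p q, f p = f q) :
    Module.finrank ℝ (LinearMap.range D) + 1 = Nat.card α := by
  have := Fintype.ofFinite α
  have hk : LinearMap.ker D = Submodule.span ℝ {1} := by
    apply le_antisymm
    · intro f hf
      rw [Submodule.mem_span_singleton]
      refine ⟨f (Classical.arbitrary α), ?_⟩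
      ext p
      simpa using h f hf _ _
    · rw [Submodule.span_singleton_le_iff_mem]
      exact h1
  have := LinearMap.finrank_range_add_finrank_ker D
  rw [hk, finrank_span_singleton (one_ne_zero), Module.finrank_fintype_fun_eq_card] at this
  rw [this, Nat.card_eq_fintype_card]

theorem reverse_diff (G : EmbeddedGraph E) {f : G.Face → ℝ} {d : Dart E}
    (h : f (G.left (d.1, true)) = f (G.right (d.1, true))) : f (G.left d) = f (G.right d) := by
  obtain ⟨x, s⟩ := d
  cases s
  · exact h.symm
  · exact h

theorem IsSphere.nonempty {G : EmbeddedGraph E} (hG : G.IsSphere) : Nonempty (Dart E) := by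
  by_contra hne
  rw [not_nonempty_iff] at hne
  have : IsEmpty G.Vertex := ⟨fun u => Quotient.inductionOn u fun d => hne.elim d⟩
  have : IsEmpty G.Face := ⟨fun u => Quotient.inductionOn u fun d => hne.elim d⟩
  have := hG.euler
  simp at this

/-- Orthogonality gives one inclusion. Both kernels consist of the constants, so the ranks are one
less than the numbers of faces and vertices; by Euler's formula they add up to the number of edges,
which forces equality. -/
theorem IsSphere.range_faceDiff [Fintype E] {G : EmbeddedGraph E} (hG : G.IsSphere) :
    LinearMap.range G.faceDiff = (LinearMap.range G.vertexDiff)ᗮ := by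
  obtain ⟨d₀⟩ := hG.nonempty
  have : Finite G.Face := Quotient.finite _
  have : Finite G.Vertex := Quotient.finite _
  have : Nonempty G.Face := ⟨G.left d₀⟩
  have : Nonempty G.Vertex := ⟨G.tail d₀⟩
  have hV := finrank_range_of_ker_const G.vertexDiff (by ext x; simp [vertexDiff]) (by
    intro f hf
    apply hG.vertex_const
    rintro ⟨x, s⟩
    have := congrArg (fun v : EuclideanSpace ℝ E => v x) hf
    simp only [vertexDiff, LinearMap.coe_mk, AddHom.coe_mk, PiLp.zero_apply] at this
    cases s
    · change f (G.head (x, true)) = f (G.tail (x, true))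
      linarith
    · linarith)
  have hF := finrank_range_of_ker_const G.faceDiff (by ext x; simp [faceDiff]) (by
    intro f hf
    apply hG.face_const
    intro d
    have := congrArg (fun v : EuclideanSpace ℝ E => v d.1) hf
    simp only [faceDiff, LinearMap.coe_mk, AddHom.coe_mk, PiLp.zero_apply] at this
    exact G.reverse_diff (by linarith))
  have ho := Submodule.finrank_add_finrank_orthogonal (LinearMap.range G.vertexDiff)
  have he := hG.euler
  rw [finrank_euclideanSpace, ← Nat.card_eq_fintype_card] at ho
  refine Submodule.eq_of_le_of_finrank_eq ?_ (by omega)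
  rintro _ ⟨f, rfl⟩
  rw [Submodule.mem_orthogonal]
  rintro _ ⟨h, rfl⟩
  rw [PiLp.inner_apply]
  simpa [faceDiff, vertexDiff, mul_comm] using G.orthogonality f h

open scoped Classical in
/-- The net number of times that a walk runs along a dart. -/
def flow (l : List (Dart E)) (d : Dart E) : ℝ := l.count d - l.count d.reverse

theorem flow_nil (d : Dart E) : flow [] d = 0 := by simp [flow]

theorem flow_append (l l' : List (Dart E)) (d : Dart E) :
    flow (l ++ l') d = flow l d + flow l' d := by
  simp [flow]; ring

theorem flow_cons (a : Dart E) (l : List (Dart E)) (d : Dart E) :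
    flow (a :: l) d = flow [a] d + flow l d := flow_append [a] l d

theorem flow_reverse (l : List (Dart E)) (d : Dart E) : flow l d.reverse = - flow l d := by
  simp [flow, Dart.reverse_reverse]

theorem flow_eq_zero {l : List (Dart E)} {d : Dart E} (h : d.1 ∉ edges l) : flow l d = 0 := by
  classical
  have h1 : d ∉ l := fun hd => h ⟨d, hd, rfl⟩
  have h2 : d.reverse ∉ l := fun hd => h ⟨_, hd, rfl⟩
  simp [flow, List.count_eq_zero_of_not_mem h1, List.count_eq_zero_of_not_mem h2]

theorem flow_eq_one {l : List (Dart E)} {d : Dart E} (h : d ∈ l) (hl : (l.map Prod.fst).Nodup) :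
    flow l d = 1 := by
  classical
  have h2 : d.reverse ∉ l := fun hd => Dart.reverse_ne d (List.inj_on_of_nodup_map hl hd h rfl)
  simp [flow, List.count_eq_one_of_mem (List.Nodup.of_map _ hl) h,
    List.count_eq_zero_of_not_mem h2]

theorem sum_flow_mul [Fintype E] (G : EmbeddedGraph E) (h : G.Vertex → ℝ) (l : List (Dart E)) :
    ∑ x : E, flow l (x, true) * (h (G.head (x, true)) - h (G.tail (x, true))) =
      (l.map fun d => h (G.head d) - h (G.tail d)).sum := by
  classical
  induction l with
  | nil => simp [flow_nil]
  | cons a l ih =>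
    rw [List.map_cons, List.sum_cons, ← ih]
    simp only [flow_cons a l, add_mul, Finset.sum_add_distrib]
    congr 1
    obtain ⟨y, s⟩ := a
    rw [Finset.sum_eq_single y]
    · cases s
      · have : flow [(y, false)] (y, true) = -1 := by simp [flow, Dart.reverse]
        rw [this]
        have e1 : G.head (y, false) = G.tail (y, true) := rfl
        have e2 : G.tail (y, false) = G.head (y, true) := rfl
        rw [e1, e2]; ring
      · have : flow [(y, true)] (y, true) = 1 := by simp [flow, Dart.reverse]
        rw [this]; ring
    · intro x _ hx
      rw [flow_eq_zero, zero_mul]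
      rintro ⟨d, hd, h⟩
      simp at hd
      subst hd
      exact hx h.symm
    · simp

theorem IsWalk.sum_sub {G : EmbeddedGraph E} (h : G.Vertex → ℝ) {l : List (Dart E)} :
    ∀ {u v}, G.IsWalk u v l → (l.map fun d => h (G.head d) - h (G.tail d)).sum = h v - h u := by
  induction l with
  | nil => intro u v hw; cases hw; simp
  | cons a l ih =>
    intro u v hw
    rw [List.map_cons, List.sum_cons, ih hw.2, hw.1]; ring

/-- On the sphere every closed walk bounds. -/
theorem IsSphere.exists_potential [Finite E] {G : EmbeddedGraph E} (hG : G.IsSphere)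
    {l : List (Dart E)} {u : G.Vertex} (hl : G.IsWalk u u l) :
    ∃ f : G.Face → ℝ, ∀ d, f (G.left d) - f (G.right d) = flow l d := by
  have := Fintype.ofFinite E
  have hm : (WithLp.toLp 2 fun x => flow l (x, true) : EuclideanSpace ℝ E) ∈
      LinearMap.range G.faceDiff := by
    -- Pairing the flow of a closed walk with a vertex coboundary gives a telescoping sum, which is
    -- zero.
    rw [hG.range_faceDiff, Submodule.mem_orthogonal]
    rintro _ ⟨h, rfl⟩
    have := G.sum_flow_mul h l
    rw [hl.sum_sub] at this
    rw [PiLp.inner_apply]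
    simpa [vertexDiff] using this
  obtain ⟨f, hf⟩ := hm
  have hx : ∀ x, f (G.left (x, true)) - f (G.right (x, true)) = flow l (x, true) := fun x =>
    congrArg (fun v : EuclideanSpace ℝ E => v x) hf
  refine ⟨f, ?_⟩
  rintro ⟨x, s⟩
  cases s
  · have h1 := flow_reverse l (x, true)
    have h2 := hx x
    change f (G.right (x, true)) - f (G.left (x, true)) = flow l (Dart.reverse (x, true))
    linarith
  · exact hx x

end EmbeddedGraph
end
-- Walks and the simple cycles they contain
namespace EmbeddedGraph

variable {E : Type*}

theorem isWalk_append {G : EmbeddedGraph E} {l l' : List (Dart E)} :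
    ∀ {u v : G.Vertex}, G.IsWalk u v (l ++ l') ↔ ∃ x, G.IsWalk u x l ∧ G.IsWalk x v l' := by
  induction l with
  | nil => intro u v; simp [IsWalk]
  | cons a l ih =>
    intro u v
    simp only [List.cons_append, IsWalk, ih]
    tauto

theorem IsWalk.append {G : EmbeddedGraph E} {l l' : List (Dart E)} {u x v : G.Vertex}
    (h : G.IsWalk u x l) (h' : G.IsWalk x v l') : G.IsWalk u v (l ++ l') :=
  isWalk_append.2 ⟨x, h, h'⟩

theorem IsWalk.reverseWalk {G : EmbeddedGraph E} {l : List (Dart E)} :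
    ∀ {u v : G.Vertex}, G.IsWalk u v l → G.IsWalk v u (reverseWalk l) := by
  induction l with
  | nil => intro u v h; exact Eq.symm h
  | cons a l ih =>
    intro u v h
    have : EmbeddedGraph.reverseWalk (a :: l) = EmbeddedGraph.reverseWalk l ++ [a.reverse] := by
      simp [EmbeddedGraph.reverseWalk]
    rw [this]
    refine (ih h.2).append ⟨rfl, ?_⟩
    rw [head_reverse]; exact h.1

theorem IsWalk.unique {G : EmbeddedGraph E} {l : List (Dart E)} :
    ∀ {u v v' : G.Vertex}, G.IsWalk u v l → G.IsWalk u v' l → v = v' := by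
  induction l with
  | nil => intro u v v' h h'; exact Eq.trans (Eq.symm h) h'
  | cons a l ih => intro u v v' h h'; exact ih h.2 h'.2

theorem IsWalk.map_tail {G : EmbeddedGraph E} {l : List (Dart E)} :
    ∀ {u v : G.Vertex}, G.IsWalk u v l → l.map G.tail ++ [v] = u :: l.map G.head := by
  induction l with
  | nil => intro u v h; cases h; rfl
  | cons a l ih =>
    intro u v h
    simp [ih h.2, h.1]

theorem edges_append (l l' : List (Dart E)) : edges (l ++ l') = edges l ∪ edges l' := by
  ext x; simp [edges, or_and_right, exists_or]

theorem edges_reverseWalk (l : List (Dart E)) : edges (reverseWalk l) = edges l := by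
  ext x
  simp [edges, reverseWalk, Dart.reverse, or_comm]

theorem edges_perm {l l' : List (Dart E)} (h : l.Perm l') : edges l = edges l' := by
  ext x; simp [edges, h.mem_iff]

theorem mem_edges {l : List (Dart E)} {d : Dart E} (h : d ∈ l) : d.1 ∈ edges l := ⟨d, h, rfl⟩

theorem length_append (w : E → ℝ≥0∞) (l l' : List (Dart E)) :
    length w (l ++ l') = length w l + length w l' := by
  simp [length]

theorem length_reverseWalk (w : E → ℝ≥0∞) (l : List (Dart E)) :
    length w (reverseWalk l) = length w l := by
  simp [length, reverseWalk, List.map_reverse, List.sum_reverse, Function.comp_def, Dart.reverse]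

theorem length_perm (w : E → ℝ≥0∞) {l l' : List (Dart E)} (h : l.Perm l') :
    length w l = length w l' := (h.map _).sum_eq

theorem not_nodup_split {α β : Type*} {f : α → β} {l : List α}
    (h : ¬ (l.map f).Nodup) :
    ∃ l₁ a l₂ a' l₃, l = l₁ ++ a :: l₂ ++ a' :: l₃ ∧ f a = f a' := by
  induction l with
  | nil => simp at h
  | cons a l ih =>
    rw [List.map_cons, List.nodup_cons, not_and_or, not_not] at h
    rcases h with h | h
    · obtain ⟨a', ha', he⟩ := List.mem_map.1 h
      obtain ⟨l₂, l₃, rfl⟩ := List.append_of_mem ha'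
      exact ⟨[], a, l₂, a', l₃, by simp, he.symm⟩
    · obtain ⟨l₁, c, l₂, a', l₃, rfl, he⟩ := ih h
      exact ⟨a :: l₁, c, l₂, a', l₃, by simp, he⟩

/-- A closed walk that repeats an edge but no vertex runs along one edge back and forth. -/
theorem IsWalk.eq_pair {G : EmbeddedGraph E} {l : List (Dart E)} {u : G.Vertex}
    (hw : G.IsWalk u u l) (ht : (l.map G.tail).Nodup) (hf : ¬ (l.map Prod.fst).Nodup) :
    ∃ a : Dart E, l.Perm [a, Dart.reverse a] := by
  obtain ⟨l₁, a, l₂, c, l₃, rfl, he⟩ := not_nodup_split hf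
  have hac : c = Dart.reverse a := by
    rcases Dart.eq_or_eq_reverse he.symm with h | h
    · subst h
      have := List.nodup_iff_sublist.1 ht (G.tail c)
      exact absurd (by simp [List.nodup_append] at ht) (fun h => h)
    · exact h
  subst hac
  rw [isWalk_append] at hw
  obtain ⟨x, hw1, hx, hw3⟩ := hw
  rw [isWalk_append] at hw1
  obtain ⟨y, hw1, hy, hw2⟩ := hw1
  have hl2 : l₂ = [] := by
    cases l₂ with
    | nil => rfl
    | cons g l₂ =>
      have h1 : G.tail g = G.tail (Dart.reverse a) := hw2.1
      simp [List.nodup_append, h1] at ht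
  have hl31 : l₃ ++ l₁ = [] := by
    have hc : G.IsWalk (G.tail a) (G.tail a) (l₃ ++ l₁) := by
      rw [head_reverse] at hw3
      rw [← hy] at hw1
      exact hw3.append hw1
    cases h31 : l₃ ++ l₁ with
    | nil => rfl
    | cons g l =>
      rw [h31] at hc
      have hg : g ∈ l₃ ++ l₁ := by rw [h31]; simp
      have h1 : G.tail a ∈ (l₃ ++ l₁).map G.tail := hc.1 ▸ List.mem_map_of_mem hg
      have hp : (l₁ ++ a :: l₂ ++ Dart.reverse a :: l₃).Perm
          (a :: (l₂ ++ Dart.reverse a :: (l₃ ++ l₁))) := by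
        rw [List.append_assoc]
        refine List.perm_append_comm.trans ?_
        simp
      have ht' := (hp.map G.tail).nodup_iff.1 ht
      rw [List.map_cons, List.nodup_cons] at ht'
      exact absurd (by simp only [List.map_append, List.map_cons, List.mem_append,
        List.mem_cons] at h1 ⊢; tauto) ht'.1
  rw [List.append_eq_nil_iff] at hl31
  exact ⟨a, by simp [hl2, hl31.1, hl31.2]⟩

/-- A closed walk that runs an odd number of times along some edge contains a simple cycle. -/
theorem exists_isCycle_of_odd [DecidableEq E] (G : EmbeddedGraph E) (w : E → ℝ≥0∞) (x : E) (n : ℕ) :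
    ∀ (l : List (Dart E)) (u : G.Vertex), l.length ≤ n → G.IsWalk u u l →
      Odd ((l.map Prod.fst).count x) →
      ∃ C, G.IsCycle C ∧ edges C ⊆ edges l ∧ length w C ≤ length w l := by
  induction n with
  | zero =>
    intro l u hn hw ho
    simp at hn
    simp [hn] at ho
  | succ n ih =>
    intro l u hn hw ho
    by_cases ht : (l.map G.tail).Nodup
    · by_cases hf : (l.map Prod.fst).Nodup
      · refine ⟨l, ⟨?_, ⟨u, hw⟩, ht, hf⟩, subset_rfl, le_rfl⟩
        rintro rfl
        simp at ho
      · obtain ⟨a, ha⟩ := hw.eq_pair ht hf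
        rw [(ha.map Prod.fst).count_eq] at ho
        by_cases hax : a.1 = x
        · simp [Dart.reverse, hax] at ho
          exact absurd ho (by decide)
        · simp [Dart.reverse, hax] at ho
    -- Cutting at a repeated vertex leaves two shorter closed walks; the counts of `x` add up to an
    -- odd number, so one of them is odd.
    · obtain ⟨l₁, a, l₂, c, l₃, rfl, he⟩ := not_nodup_split ht
      rw [isWalk_append] at hw
      obtain ⟨y, hw, hy, hw3⟩ := hw
      rw [isWalk_append] at hw
      obtain ⟨z, hw1, hz, hw2⟩ := hw
      have hzy : z = y := by rw [← hy, ← hz, he]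
      subst hzy
      have hA : G.IsWalk z z (a :: l₂) := ⟨hz, hw2⟩
      have hB : G.IsWalk u u (l₁ ++ c :: l₃) := hw1.append ⟨hy, hw3⟩
      simp only [List.length_append, List.length_cons] at hn
      have hp : (l₁ ++ a :: l₂ ++ c :: l₃).Perm (a :: l₂ ++ (l₁ ++ c :: l₃)) := by
        rw [← List.append_assoc]
        exact List.perm_append_comm.append_right _
      rw [(hp.map Prod.fst).count_eq, List.map_append, List.count_append] at ho
      rw [edges_perm hp, length_perm w hp, edges_append, length_append]
      rcases Nat.even_or_odd (((a :: l₂).map Prod.fst).count x) with h | h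
      · obtain ⟨C, h1, h2, h3⟩ := ih _ u (by simp; omega) hB
          ((Nat.odd_add'.1 ho).2 h)
        exact ⟨C, h1, h2.trans Set.subset_union_right, h3.trans le_add_self⟩
      · obtain ⟨C, h1, h2, h3⟩ := ih _ z (by simp; omega) hA h
        exact ⟨C, h1, h2.trans Set.subset_union_left, h3.trans le_self_add⟩

/-! ### The Jordan curve theorem -/

/-- Along a simple cycle, the difference between the two sides of a function that is constant
away from the cycle does not change. -/
theorem IsCycle.exists_diff_eq [Finite E] {G : EmbeddedGraph E} {C : List (Dart E)}
    (hC : G.IsCycle C) (f : G.Face → ℝ)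
    (hf : ∀ d : Dart E, d.1 ∉ edges C → f (G.left d) = f (G.right d)) :
    ∃ a : ℝ, ∀ d ∈ C, f (G.left d) - f (G.right d) = a := by
  classical
  have := Fintype.ofFinite E
  obtain ⟨hne, ⟨u, hw⟩, ht, he⟩ := hC
  have hnd : C.Nodup := List.Nodup.of_map _ he
  have hh : (C.map G.head).Nodup := by
    have h1 := hw.map_tail
    have h2 : (C.map G.tail).Perm (C.map G.head) := by
      rw [← List.perm_cons u, ← h1]
      exact (List.perm_append_singleton _ _).symm
    exact h2.nodup_iff.1 ht
  have horth : ∀ h : G.Vertex → ℝ,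
      ∑ d ∈ C.toFinset, (f (G.left d) - f (G.right d)) * (h (G.head d) - h (G.tail d)) = 0 := by
    intro h
    rw [← G.orthogonality f h]
    have hinj : Set.InjOn Prod.fst (C.toFinset : Set (Dart E)) := by
      intro d hd d' hd' hdd
      exact List.inj_on_of_nodup_map he (by simpa using hd) (by simpa using hd') hdd
    rw [← Finset.sum_subset (Finset.subset_univ (C.toFinset.image Prod.fst)),
      Finset.sum_image hinj]
    · refine Finset.sum_congr rfl ?_
      rintro ⟨x, s⟩ _
      cases s
      · have e1 : G.head (x, false) = G.tail (x, true) := rfl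
        have e2 : G.tail (x, false) = G.head (x, true) := rfl
        have e3 : G.left (x, false) = G.right (x, true) := rfl
        have e4 : G.right (x, false) = G.left (x, true) := rfl
        rw [e1, e2, e3, e4]; ring
      · rfl
    · intro x _ hx
      rw [hf, sub_self, zero_mul]
      rintro ⟨d, hd, h⟩
      exact hx (Finset.mem_image.2 ⟨d, by simpa using hd, h⟩)
  have hstep : ∀ d ∈ C, ∀ d' ∈ C, G.head d = G.tail d' →
      f (G.left d) - f (G.right d) = f (G.left d') - f (G.right d') := by
    intro d hd d' hd' hdd
    -- Testing against the indicator of one vertex leaves only the darts of the cycle that enter and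
    -- leave it.
    have := horth (fun x => if x = G.head d then 1 else 0)
    simp only [mul_sub, Finset.sum_sub_distrib] at this
    rw [Finset.sum_eq_single d, Finset.sum_eq_single d'] at this
    · simp [hdd] at this; linarith
    · intro g hg hgd
      rw [if_neg, mul_zero]
      intro h
      exact hgd (List.inj_on_of_nodup_map ht (by simpa using hg) hd' (h.trans hdd))
    · intro h; exact absurd hd' (by simpa using h)
    · intro g hg hgd
      rw [if_neg, mul_zero]
      intro h
      exact hgd (List.inj_on_of_nodup_map hh (by simpa using hg) hd h)
    · intro h; exact absurd hd (by simpa using h)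
  have key : ∀ (l : List (Dart E)) (a : Dart E) (x y : G.Vertex), (∀ d ∈ a :: l, d ∈ C) →
      G.IsWalk x y (a :: l) → ∀ d ∈ a :: l,
        f (G.left d) - f (G.right d) = f (G.left a) - f (G.right a) := by
    intro l
    induction l with
    | nil =>
      intro a x y _ _ d hd
      simp at hd
      rw [hd]
    | cons c l ih =>
      intro a x y hl hw d hd
      rcases List.mem_cons.1 hd with rfl | hd
      · rfl
      rw [ih c _ _ (fun d hd => hl d (by simp [List.mem_cons.1 hd])) hw.2 d hd]
      exact (hstep a (hl a (by simp)) c (hl c (by simp)) hw.2.1.symm).symm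
  cases C with
  | nil => exact absurd rfl hne
  | cons a l => exact ⟨_, key l a u u (fun d hd => hd) hw⟩

/-- The Jordan curve theorem: a function that is constant away from a simple cycle is constant
inside the cycle and constant outside of it. -/
theorem IsSphere.eq_of_mem_interior_iff [Finite E] {G : EmbeddedGraph E} (hG : G.IsSphere)
    (o : G.Face) {C : List (Dart E)} (hC : G.IsCycle C) (f : G.Face → ℝ)
    (hf : ∀ d : Dart E, d.1 ∉ edges C → f (G.left d) = f (G.right d)) {p q : G.Face}
    (hpq : p ∈ G.interior o (edges C) ↔ q ∈ G.interior o (edges C)) : f p = f q := by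
  classical
  let g : G.Face → ℝ := fun x => if x ∈ G.interior o (edges C) then 1 else 0
  have hmono : ∀ d : Dart E, d.1 ∉ edges C → G.left d ∉ G.interior o (edges C) →
      G.right d ∉ G.interior o (edges C) := by
    intro d hd h
    simp only [interior, Set.mem_ofPred_eq, not_not] at h ⊢
    exact h.tail ⟨d, hd, rfl, rfl⟩
  have hg : ∀ d : Dart E, d.1 ∉ edges C → g (G.left d) = g (G.right d) := by
    intro d hd
    have h : G.left d ∈ G.interior o (edges C) ↔ G.right d ∈ G.interior o (edges C) := by
      rw [← not_iff_not]
      refine ⟨hmono d hd, fun h => ?_⟩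
      have := hmono d.reverse hd h
      rwa [right_reverse] at this
    simp only [g, h]
  obtain ⟨a, ha⟩ := hC.exists_diff_eq f hf
  obtain ⟨c, hc⟩ := hC.exists_diff_eq g hg
  -- The jumps along `C` are `a` for `f` and `c` for the indicator `g`, so this combination has no
  -- jump anywhere.
  have hlin : ∀ p q, c * f p - a * g p = c * f q - a * g q := by
    refine hG.face_const (fun x => c * f x - a * g x) (fun d => ?_)
    by_cases hd : d.1 ∈ edges C
    · obtain ⟨d', hd', he⟩ := hd
      rcases Dart.eq_or_eq_reverse he with h | h
      · have h1 := ha _ hd'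
        have h2 := hc _ hd'
        rw [h] at h1 h2
        linear_combination c * h1 - a * h2
      · have h1 := ha _ hd'
        have h2 := hc _ hd'
        rw [h, right_reverse] at h1 h2
        change f (G.right d) - _ = _ at h1
        change g (G.right d) - _ = _ at h2
        linear_combination a * h2 - c * h1
    · rw [hf d hd, hg d hd]
  have hgpq : g p = g q := by simp only [g, hpq]
  by_cases hpo : p ∈ G.interior o (edges C)
  -- With `c = 0` the indicator would be constant, although it differs at `p` and `o`.
  · have hc0 : c ≠ 0 := by
      intro hc0
      have hgc := hG.face_const g (fun d => by
        by_cases hd : d.1 ∈ edges C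
        · obtain ⟨d', hd', he⟩ := hd
          have h2 := hc _ hd'
          rcases Dart.eq_or_eq_reverse he with h | h
          · rw [h] at h2; linarith
          · rw [h, right_reverse] at h2
            change g (G.right d) - _ = _ at h2
            linarith
        · exact hg d hd) p o
      have ho : o ∉ G.interior o (edges C) := fun h => h .refl
      simp [g, hpo, ho] at hgc
    have := hlin p q
    rw [hgpq] at this
    exact mul_left_cancel₀ hc0 (by linarith)
  · have hout : ∀ p, p ∉ G.interior o (edges C) → f p = f o := by
      intro p hp
      simp only [interior, Set.mem_ofPred_eq, not_not] at hp
      induction hp with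
      | refl => rfl
      | tail _ h ih =>
        obtain ⟨d, hd, rfl, rfl⟩ := h
        rw [← ih, hf d hd]
    rw [hout p hpo, hout q (fun h => hpo (hpq.2 h))]

end EmbeddedGraph
-- Sides of a cycle and pieces of a walk
namespace EmbeddedGraph

variable {E : Type*}

theorem incident_left (G : EmbeddedGraph E) (d : Dart E) : G.Incident (G.left d) d.1 := by
  obtain ⟨x, s⟩ := d
  cases s
  · exact Or.inr rfl
  · exact Or.inl rfl

theorem incident_right (G : EmbeddedGraph E) (d : Dart E) : G.Incident (G.right d) d.1 :=
  G.incident_left d.reverse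

theorem Incident.eq_or {G : EmbeddedGraph E} {f : G.Face} {d : Dart E} (h : G.Incident f d.1) :
    f = G.left d ∨ f = G.right d := by
  obtain ⟨x, s⟩ := d
  cases s
  · exact h.symm.imp Eq.symm Eq.symm
  · exact h.imp Eq.symm Eq.symm

/-- Both sides of the dart lie in `K`. -/
def Strict (G : EmbeddedGraph E) (K : Set G.Face) (d : Dart E) : Prop :=
  G.left d ∈ K ∧ G.right d ∈ K

theorem strict_reverse {G : EmbeddedGraph E} {K : Set G.Face} {d : Dart E} :
    G.Strict K d.reverse ↔ G.Strict K d := by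
  rw [Strict, right_reverse]; exact and_comm

theorem left_mem_interior_iff {G : EmbeddedGraph E} {o : G.Face} {C : Set E} {d : Dart E}
    (hd : d.1 ∉ C) : G.left d ∈ G.interior o C ↔ G.right d ∈ G.interior o C := by
  have hmono : ∀ d : Dart E, d.1 ∉ C → G.left d ∉ G.interior o C →
      G.right d ∉ G.interior o C := by
    intro d hd h
    simp only [interior, Set.mem_ofPred_eq, not_not] at h ⊢
    exact h.tail ⟨d, hd, rfl, rfl⟩
  rw [← not_iff_not]
  refine ⟨hmono d hd, fun h => ?_⟩
  have := hmono d.reverse hd h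
  rwa [right_reverse] at this

theorem flow_reverseWalk (l : List (Dart E)) (d : Dart E) : flow (reverseWalk l) d = - flow l d := by
  induction l with
  | nil => simp [reverseWalk, flow_nil]
  | cons a l ih =>
    have h : reverseWalk (a :: l) = reverseWalk l ++ [a.reverse] := by simp [reverseWalk]
    have h1 : flow [a.reverse] d = - flow [a] d := by
      rw [← flow_reverse]
      classical
      have e1 : (a.reverse = d) ↔ (a = d.reverse) :=
        ⟨fun h => by rw [← h, Dart.reverse_reverse], fun h => by rw [h, Dart.reverse_reverse]⟩
      have e2 : (a.reverse = d.reverse) ↔ (a = d) :=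
        ⟨fun h => by rw [← Dart.reverse_reverse a, h, Dart.reverse_reverse], fun h => by rw [h]⟩
      simp [flow, List.count_singleton, Dart.reverse_reverse, e1, e2]
    rw [h, flow_append, ih, h1, flow_cons a l]
    ring

theorem IsWalk.head_mem {G : EmbeddedGraph E} {l : List (Dart E)} {u : G.Vertex}
    (hw : G.IsWalk u u l) {d : Dart E} (hd : d ∈ l) : ∃ d' ∈ l, G.tail d' = G.head d := by
  have h1 := hw.map_tail
  have h2 : (l.map G.tail).Perm (l.map G.head) := by
    rw [← List.perm_cons u, ← h1]
    exact (List.perm_append_singleton _ _).symm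
  exact List.mem_map.1 (h2.mem_iff.2 (List.mem_map_of_mem hd))

theorem IsWalk.eq_of_ne_nil {G : EmbeddedGraph E} {l : List (Dart E)} {u v u' v' : G.Vertex}
    (h : G.IsWalk u v l) (h' : G.IsWalk u' v' l) (hl : l ≠ []) : u = u' ∧ v = v' := by
  cases l with
  | nil => exact absurd rfl hl
  | cons a l => exact ⟨h.1.symm.trans h'.1, h.2.unique h'.2⟩

/-- A nonempty walk between vertices of `V` with no inner vertex in `V`. -/
structure IsPiece (G : EmbeddedGraph E) (V : Set G.Vertex) (x y : G.Vertex)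
    (Q : List (Dart E)) : Prop where
  walk : G.IsWalk x y Q
  ne_nil : Q ≠ []
  start_mem : x ∈ V
  end_mem : y ∈ V
  inner : ∀ d ∈ Q.tail, G.tail d ∉ V

theorem IsWalk.exists_first {G : EmbeddedGraph E} {V : Set G.Vertex} {l : List (Dart E)} :
    ∀ {u v : G.Vertex}, G.IsWalk u v l → v ∈ V → ∃ l₁ l₂ x, l = l₁ ++ l₂ ∧ x ∈ V ∧
      G.IsWalk u x l₁ ∧ G.IsWalk x v l₂ ∧ ∀ d ∈ l₁, G.tail d ∉ V := by
  induction l with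
  | nil =>
    intro u v h hv
    cases h
    exact ⟨[], [], u, rfl, hv, rfl, rfl, by simp⟩
  | cons a l ih =>
    intro u v h hv
    by_cases hu : u ∈ V
    · exact ⟨[], a :: l, u, rfl, hu, rfl, h, by simp⟩
    · obtain ⟨l₁, l₂, x, rfl, hx, h1, h2, h3⟩ := ih h.2 hv
      refine ⟨a :: l₁, l₂, x, rfl, hx, ⟨h.1, h1⟩, h2, ?_⟩
      intro d hd
      rcases List.mem_cons.1 hd with rfl | hd
      · rwa [h.1]
      · exact h3 d hd

theorem IsWalk.exists_pieces {G : EmbeddedGraph E} {V : Set G.Vertex} (n : ℕ) :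
    ∀ {l : List (Dart E)} {u v : G.Vertex}, l.length ≤ n → G.IsWalk u v l → u ∈ V → v ∈ V →
      ∃ L : List (List (Dart E)), L.flatten = l ∧ ∀ Q ∈ L, ∃ x y, G.IsPiece V x y Q := by
  induction n with
  | zero =>
    intro l u v hn _ _ _
    exact ⟨[], by simpa using hn, by simp⟩
  | succ n ih =>
    intro l u v hn h hu hv
    cases l with
    | nil => exact ⟨[], rfl, by simp⟩
    | cons a l =>
      obtain ⟨l₁, l₂, x, rfl, hx, h1, h2, h3⟩ := h.2.exists_first hv
      simp only [List.length_cons, List.length_append] at hn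
      obtain ⟨L, rfl, hL⟩ := ih (by omega) h2 hx hv
      refine ⟨(a :: l₁) :: L, by simp, ?_⟩
      intro Q hQ
      rcases List.mem_cons.1 hQ with rfl | hQ
      · exact ⟨u, x, ⟨h.1, h1⟩, by simp, hu, hx, h3⟩
      · exact hL Q hQ

/-- The rest of a closed walk leads from the end of the piece back to its start; its length bounds
that of any shortest path closing the piece. -/
theorem exists_rotation {G : EmbeddedGraph E} {L : List (List (Dart E))} {u : G.Vertex}
    (h : G.IsWalk u u L.flatten) {Q : List (Dart E)} (hQ : Q ∈ L) :
    ∃ L', L.Perm (Q :: L') ∧ ∃ x y, G.IsWalk x y Q ∧ G.IsWalk y x L'.flatten := by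
  obtain ⟨L₁, L₂, rfl⟩ := List.append_of_mem hQ
  refine ⟨L₂ ++ L₁, List.perm_append_comm, ?_⟩
  rw [List.flatten_append, List.flatten_cons, isWalk_append] at h
  obtain ⟨x, h1, h2⟩ := h
  rw [isWalk_append] at h2
  obtain ⟨y, h2, h3⟩ := h2
  exact ⟨x, y, h2, by rw [List.flatten_append]; exact h3.append h1⟩

/-! ### Cycles formed by two shortest paths and an edge -/

/-- What the exchange argument uses of a cycle `S` that consists of an edge and of two shortest
paths that start at the same vertex `z`: `A` and `B` are the vertex sets of the two paths, `e` is
the additional edge, and `b` is the first dart of the second path. -/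
structure IsGeodesicCycle (G : EmbeddedGraph E) (w : E → ℝ≥0∞) (o : G.Face) (S : List (Dart E))
    (A B : Set G.Vertex) (z : G.Vertex) (e b : Dart E) : Prop where
  separates : ∀ d : Dart E, d.1 ∈ edges S →
    (G.left d ∈ G.interior o (edges S) ↔ G.right d ∉ G.interior o (edges S))
  jordan : ∀ f : G.Face → ℝ, (∀ d : Dart E, d.1 ∉ edges S → f (G.left d) = f (G.right d)) →
    ∀ {p q : G.Face}, (p ∈ G.interior o (edges S) ↔ q ∈ G.interior o (edges S)) → f p = f q
  tail_mem : ∀ d : Dart E, d.1 ∈ edges S → G.tail d ∈ A ∪ B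
  left_geodesic : ∀ x ∈ A, ∀ y ∈ A, ∃ p, G.IsWalk x y p ∧ edges p ⊆ edges S ∧
    ∀ q, G.IsWalk x y q → length w p ≤ length w q
  right_geodesic : ∀ x ∈ B, ∀ y ∈ B, ∃ p, G.IsWalk x y p ∧ edges p ⊆ edges S ∧
    ∀ q, G.IsWalk x y q → length w p ≤ length w q
  through : ∀ x ∈ A, ∀ y ∈ B, y ≠ z → ∃ p, G.IsWalk y x p ∧ edges p ⊆ edges S ∧ e.1 ∉ edges p ∧
    flow p b = -1 ∧ ∀ q q', G.IsWalk y z q → G.IsWalk z x q' →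
      length w p ≤ length w q + length w q'
  apex_left : z ∈ A
  apex_right : z ∈ B
  tail_b : G.tail b = z
  b_mem : b.1 ∈ edges S
  e_mem : e.1 ∈ edges S

namespace IsGeodesicCycle

variable {G : EmbeddedGraph E} {w : E → ℝ≥0∞} {o : G.Face} {S : List (Dart E)}
  {A B : Set G.Vertex} {z : G.Vertex} {e b : Dart E}

theorem not_mem_of_strict (hS : G.IsGeodesicCycle w o S A B z e b) {K : Set G.Face}
    (hK : K = G.interior o (edges S) ∨ K = (G.interior o (edges S))ᶜ) {d : Dart E}
    (hd : G.Strict K d) : d.1 ∉ edges S := by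
  intro h
  have h1 := hS.separates d h
  rcases hK with rfl | rfl
  · exact h1.1 hd.1 hd.2
  · exact hd.1 (h1.2 hd.2)

theorem strict_of_not_mem {d : Dart E} (hd : d.1 ∉ edges S) {K : Set G.Face}
    (hK : K = G.interior o (edges S) ∨ K = (G.interior o (edges S))ᶜ) :
    G.left d ∈ K ↔ G.right d ∈ K := by
  have := left_mem_interior_iff (o := o) hd
  rcases hK with rfl | rfl
  · exact this
  · exact not_congr this

/-- Rotating about a vertex off `S` crosses only edges that are not in `S`. -/
theorem left_iff_of_tail (hS : G.IsGeodesicCycle w o S A B z e b) {d d' : Dart E}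
    (h : G.tail d = G.tail d') (hd : G.tail d ∉ A ∪ B) :
    G.left d ∈ G.interior o (edges S) ↔ G.left d' ∈ G.interior o (edges S) := by
  have hr : ∀ c : Dart E, G.tail c = G.tail d →
      (G.left (G.rot c) ∈ G.interior o (edges S) ↔ G.left c ∈ G.interior o (edges S)) := by
    intro c hc
    rw [left_mem_interior_iff, right_rot]
    intro hm
    have := hS.tail_mem _ hm
    rw [tail_rot, hc] at this
    exact hd this
  have ht : ∀ n : ℤ, G.tail ((G.rot ^ n) d) = G.tail d := fun n =>
    Quotient.sound (Equiv.Perm.sameCycle_zpow_left.2 (Equiv.Perm.SameCycle.refl _ _))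
  have hz : ∀ n : ℤ, (G.left ((G.rot ^ n) d) ∈ G.interior o (edges S) ↔
      G.left d ∈ G.interior o (edges S)) := by
    intro n
    induction n with
    | zero => simp
    | succ n ih =>
      rw [add_comm, zpow_add, Equiv.Perm.mul_apply, zpow_one]
      exact (hr _ (ht _)).trans ih
    | pred n ih =>
      have h1 := hr ((G.rot ^ (-(n : ℤ) - 1)) d) (ht _)
      rw [← Equiv.Perm.mul_apply, ← zpow_one_add, add_sub_cancel] at h1
      exact h1.symm.trans ih
  obtain ⟨n, hn⟩ : G.rot.SameCycle d d' := Quotient.exact h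
  rw [← hn]
  exact (hz n).symm

/-- A walk whose inner vertices avoid `S` runs along an edge of `S`, or inside of `S`, or
outside of `S`. -/
theorem side_of_inner (hS : G.IsGeodesicCycle w o S A B z e b) {Q : List (Dart E)} :
    ∀ {x y : G.Vertex}, G.IsWalk x y Q → (∀ d ∈ Q.tail, G.tail d ∉ A ∪ B) →
      (∀ d ∈ Q, d.1 ∈ edges S) ∨ (∀ d ∈ Q, G.Strict (G.interior o (edges S)) d) ∨
        (∀ d ∈ Q, G.Strict (G.interior o (edges S))ᶜ d) := by
  have hdart : ∀ d : Dart E, d.1 ∉ edges S → G.Strict (G.interior o (edges S)) d ∨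
      G.Strict (G.interior o (edges S))ᶜ d := by
    intro d hd
    have := left_mem_interior_iff (o := o) hd
    by_cases h : G.left d ∈ G.interior o (edges S)
    · exact Or.inl ⟨h, this.1 h⟩
    · exact Or.inr ⟨h, fun h' => h (this.2 h')⟩
  induction Q with
  | nil => intro x y _ _; simp
  | cons a Q ih =>
    intro x y hw hi
    cases Q with
    | nil =>
      by_cases ha : a.1 ∈ edges S
      · simp [ha]
      · simpa using Or.inr (hdart a ha)
    | cons c Q =>
      have hc : G.tail c ∉ A ∪ B := hi c (by simp)
      have hac : G.tail c = G.tail a.reverse := hw.2.1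
      have hcS : c.1 ∉ edges S := fun h => hc (hS.tail_mem c h)
      have haS : a.1 ∉ edges S := fun h => hc (hac ▸ hS.tail_mem a.reverse h)
      have hlr : G.left c ∈ G.interior o (edges S) ↔ G.right a ∈ G.interior o (edges S) :=
        hS.left_iff_of_tail hac hc
      rcases ih hw.2 (fun d hd => hi d (by simpa using Or.inr hd)) with h | h | h
      · exact absurd (h c (by simp)) hcS
      · right; left
        intro d hd
        rcases List.mem_cons.1 hd with rfl | hd
        · have := hlr.1 (h c (by simp)).1
          exact ⟨(left_mem_interior_iff haS).2 this, this⟩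
        · exact h d hd
      · right; right
        intro d hd
        rcases List.mem_cons.1 hd with rfl | hd
        · have : G.right d ∉ G.interior o (edges S) := fun h' => (h c (by simp)).1 (hlr.2 h')
          exact ⟨fun h' => this ((left_mem_interior_iff haS).1 h'), this⟩
        · exact h d hd

/-- An edge of `S` has one side inside and one outside, so it belongs to both closed sides and never
causes a crossing. -/
theorem not_crosses (hS : G.IsGeodesicCycle w o S A B z e b) {K : Set G.Face}
    (hK : K = G.interior o (edges S) ∨ K = (G.interior o (edges S))ᶜ) {C : List (Dart E)}
    (hC : ∀ d ∈ C, G.Strict K d ∨ d.1 ∈ edges S) : ¬ G.Crosses o C S := by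
  rintro ⟨h1, h2⟩
  rcases hK with rfl | rfl
  · apply h1
    rintro _ ⟨d, hd, rfl⟩
    rcases hC d hd with h | h
    · exact ⟨_, h.1, G.incident_left d⟩
    · by_cases h' : G.left d ∈ G.interior o (edges S)
      · exact ⟨_, h', G.incident_left d⟩
      · exact ⟨_, not_not.1 (fun hh => h' ((hS.separates d h).2 hh)), G.incident_right d⟩
  · apply h2
    rintro _ ⟨d, hd, rfl⟩
    rcases hC d hd with h | h
    · exact ⟨_, h.1, G.incident_left d⟩
    · by_cases h' : G.left d ∈ G.interior o (edges S)
      · exact ⟨_, (hS.separates d h).1 h', G.incident_right d⟩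
      · exact ⟨_, h', G.incident_left d⟩

/-- A closed walk that runs on one side of `S` and along `S` contains a cycle that does not
cross `S`. -/
theorem exists_noncrossing (hS : G.IsGeodesicCycle w o S A B z e b) {K : Set G.Face}
    (hK : K = G.interior o (edges S) ∨ K = (G.interior o (edges S))ᶜ) {W D p : List (Dart E)}
    {u : G.Vertex} (hW : G.IsWalk u u W) (hp : W.Perm (D ++ p)) (hD : D ≠ [])
    (hDK : ∀ d ∈ D, G.Strict K d) (hnd : (D.map Prod.fst).Nodup) (hpS : edges p ⊆ edges S) :
    ∃ C', G.IsCycle C' ∧ ¬ G.Crosses o C' S ∧ length w C' ≤ length w W := by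
  classical
  obtain ⟨a, ha⟩ := List.exists_mem_of_ne_nil D hD
  have haS := hS.not_mem_of_strict hK (hDK a ha)
  -- An edge of `D` is off `S` and occurs once in `W`; this oddness keeps the closed walk from being
  -- mere backtracking.
  obtain ⟨C', h1, h2, h3⟩ := G.exists_isCycle_of_odd w a.1 W.length W u le_rfl hW (by
    rw [(hp.map Prod.fst).count_eq, List.map_append, List.count_append,
      List.count_eq_one_of_mem hnd (List.mem_map_of_mem ha), List.count_eq_zero_of_not_mem]
    · exact odd_one
    · intro h
      obtain ⟨d, hd, hda⟩ := List.mem_map.1 h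
      exact haS (hpS ⟨d, hd, hda⟩))
  refine ⟨C', h1, hS.not_crosses hK ?_, h3⟩
  intro d hd
  obtain ⟨d', hd', he⟩ := h2 (mem_edges hd)
  rcases List.mem_append.1 (hp.mem_iff.1 hd') with h | h
  · left
    rcases Dart.eq_or_eq_reverse he with rfl | rfl
    · exact hDK _ h
    · exact strict_reverse.1 (hDK _ h)
  · right
    exact hpS ⟨d', h, he⟩

end IsGeodesicCycle

end EmbeddedGraph
-- The exchanges
namespace EmbeddedGraph

variable {E : Type*}

namespace IsGeodesicCycle

variable {G : EmbeddedGraph E} {w : E → ℝ≥0∞} {o : G.Face} {S : List (Dart E)}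
  {A B : Set G.Vertex} {z : G.Vertex} {e b : Dart E}

theorem geodesic (hS : G.IsGeodesicCycle w o S A B z e b) {X : Set G.Vertex} (hX : X = A ∨ X = B)
    {x y : G.Vertex} (hx : x ∈ X) (hy : y ∈ X) : ∃ p, G.IsWalk x y p ∧ edges p ⊆ edges S ∧
      ∀ q, G.IsWalk x y q → length w p ≤ length w q := by
  rcases hX with rfl | rfl
  · exact hS.left_geodesic x hx y hy
  · exact hS.right_geodesic x hx y hy

variable {K : Set G.Face} {L : List (List (Dart E))} {u : G.Vertex}

/-- A piece of a closed walk with both ends on the same path can be closed up along that path. -/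
theorem exists_of_same_path (hS : G.IsGeodesicCycle w o S A B z e b)
    (hK : K = G.interior o (edges S) ∨ K = (G.interior o (edges S))ᶜ)
    (hw : G.IsWalk u u L.flatten) (hnd : (L.flatten.map Prod.fst).Nodup)
    {Q : List (Dart E)} (hQ : Q ∈ L) (hQK : ∀ d ∈ Q, G.Strict K d) {x y : G.Vertex}
    (hp : G.IsPiece (A ∪ B) x y Q) {X : Set G.Vertex} (hX : X = A ∨ X = B)
    (hx : x ∈ X) (hy : y ∈ X) :
    ∃ C', G.IsCycle C' ∧ ¬ G.Crosses o C' S ∧ length w C' ≤ length w L.flatten := by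
  obtain ⟨L', hL', x', y', h1, h2⟩ := exists_rotation hw hQ
  obtain ⟨rfl, rfl⟩ := hp.walk.eq_of_ne_nil h1 hp.ne_nil
  obtain ⟨p, hpw, hpS, hpl⟩ := hS.geodesic hX hy hx
  have hf := hL'.flatten
  rw [List.flatten_cons] at hf
  obtain ⟨C', h3, h4, h5⟩ := hS.exists_noncrossing hK (h1.append hpw) (.refl _) hp.ne_nil hQK
    (by
      have := (hf.map Prod.fst).nodup_iff.1 hnd
      rw [List.map_append] at this
      exact this.of_append_left) hpS
  refine ⟨C', h3, h4, h5.trans ?_⟩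
  rw [length_perm w hf, length_append, length_append]
  gcongr
  exact hpl _ h2

/-- Two pieces on the same side that run in opposite directions between the two paths can be
joined along the paths. -/
theorem exists_of_opposite (hS : G.IsGeodesicCycle w o S A B z e b)
    (hK : K = G.interior o (edges S) ∨ K = (G.interior o (edges S))ᶜ)
    (hw : G.IsWalk u u L.flatten) (hnd : (L.flatten.map Prod.fst).Nodup)
    {Q Q' : List (Dart E)} (hQ : Q ∈ L) (hQK : ∀ d ∈ Q, G.Strict K d) (hQ' : Q' ∈ L)
    (hQK' : ∀ d ∈ Q', G.Strict K d) {x y x' y' : G.Vertex}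
    (hp : G.IsPiece (A ∪ B) x y Q) (hp' : G.IsPiece (A ∪ B) x' y' Q')
    (hx : x ∈ A) (hxB : x ∉ B) (hy : y ∈ B) (hx' : x' ∈ B) (hy' : y' ∈ A) :
    ∃ C', G.IsCycle C' ∧ ¬ G.Crosses o C' S ∧ length w C' ≤ length w L.flatten := by
  obtain ⟨L', hL', x₁, y₁, h1, h2⟩ := exists_rotation hw hQ
  obtain ⟨rfl, rfl⟩ := hp.walk.eq_of_ne_nil h1 hp.ne_nil
  -- The two pieces differ: `Q'` starts in `B`, and `Q` does not.
  have hmem : Q' ∈ L' := by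
    rcases List.mem_cons.1 (hL'.mem_iff.1 hQ') with rfl | h
    · obtain ⟨rfl, rfl⟩ := hp'.walk.eq_of_ne_nil h1 hp.ne_nil
      exact absurd hx' hxB
    · exact h
  obtain ⟨M₁, M₂, rfl⟩ := List.append_of_mem hmem
  rw [List.flatten_append, List.flatten_cons, isWalk_append] at h2
  obtain ⟨x₂, h2, h3⟩ := h2
  rw [isWalk_append] at h3
  obtain ⟨y₂, h3, h4⟩ := h3
  obtain ⟨rfl, rfl⟩ := hp'.walk.eq_of_ne_nil h3 hp'.ne_nil
  -- `p` and `p'` replace the two stretches of the closed walk between `Q` and `Q'`.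
  obtain ⟨p, hpw, hpS, hpl⟩ := hS.right_geodesic _ hy _ hx'
  obtain ⟨p', hpw', hpS', hpl'⟩ := hS.left_geodesic _ hy' _ hx
  have hf := hL'.flatten
  rw [List.flatten_cons, List.flatten_append, List.flatten_cons] at hf
  have hperm : (Q ++ (p ++ (Q' ++ p'))).Perm ((Q ++ Q') ++ (p ++ p')) := by
    rw [List.append_assoc]
    refine List.Perm.append_left _ ?_
    rw [← List.append_assoc, ← List.append_assoc]
    exact List.perm_append_comm.append_right _
  obtain ⟨C', h6, h7, h8⟩ := hS.exists_noncrossing hK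
    (h1.append (hpw.append (h3.append hpw'))) hperm (by simp [hp.ne_nil])
    (fun d hd => (List.mem_append.1 hd).elim (hQK d) (hQK' d))
    (by
      have h := (hf.map Prod.fst).nodup_iff.1 hnd
      refine h.sublist (List.Sublist.map _ ?_)
      exact (List.Sublist.refl Q).append
        ((List.sublist_append_left Q' _).trans (List.sublist_append_right _ _)))
    (by rw [edges_append]; exact Set.union_subset hpS hpS')
  refine ⟨C', h6, h7, h8.trans ?_⟩
  rw [length_perm w hf]
  simp only [length_append]
  gcongr
  · exact hpl _ h2
  · exact hpl' _ h4

/-- If the closed walk visits the common start of the two paths, then every piece off `S` can be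
closed up through this vertex. -/
theorem exists_of_apex (hS : G.IsGeodesicCycle w o S A B z e b)
    (hK : K = G.interior o (edges S) ∨ K = (G.interior o (edges S))ᶜ)
    (hw : G.IsWalk u u L.flatten) (hnd : (L.flatten.map Prod.fst).Nodup)
    {Q : List (Dart E)} (hQ : Q ∈ L) (hQK : ∀ d ∈ Q, G.Strict K d) {x y : G.Vertex}
    (hp : G.IsPiece (A ∪ B) x y Q) {d : Dart E} (hd : d ∈ L.flatten) (hdz : G.tail d = z) :
    ∃ C', G.IsCycle C' ∧ ¬ G.Crosses o C' S ∧ length w C' ≤ length w L.flatten := by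
  have hA := fun hx hy => hS.exists_of_same_path hK hw hnd hQ hQK hp (.inl rfl) hx hy
  have hB := fun hx hy => hS.exists_of_same_path hK hw hnd hQ hQK hp (.inr rfl) hx hy
  by_cases hxz : x = z
  · subst hxz
    exact hp.end_mem.elim (hA hS.apex_left) (hB hS.apex_right)
  by_cases hyz : y = z
  · subst hyz
    exact hp.start_mem.elim (fun h => hA h hS.apex_left) (fun h => hB h hS.apex_right)
  obtain ⟨L', hL', x₁, y₁, h1, h2⟩ := exists_rotation hw hQ
  obtain ⟨rfl, rfl⟩ := hp.walk.eq_of_ne_nil h1 hp.ne_nil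
  have hf := hL'.flatten
  rw [List.flatten_cons] at hf
  -- The visit to `z` cannot occur in `Q`, which does not start at `z` and whose inner vertices
  -- avoid `S`.
  have hdL : d ∈ L'.flatten := by
    rcases List.mem_append.1 (hf.mem_iff.1 hd) with h | h
    · cases Q with
      | nil => exact absurd rfl hp.ne_nil
      | cons a Q =>
        rcases List.mem_cons.1 h with rfl | h
        · exact absurd (hp.walk.1.symm.trans hdz) hxz
        · exact absurd (hdz ▸ .inl hS.apex_left) (hp.inner d h)
    · exact h
  obtain ⟨r₁, r₂, hr⟩ := List.append_of_mem hdL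
  rw [hr, isWalk_append] at h2
  obtain ⟨z', h2, h3⟩ := h2
  obtain rfl : z = z' := hdz.symm.trans h3.1
  have hfin : ∀ p, G.IsWalk y x p → edges p ⊆ edges S →
      length w p ≤ length w r₁ + length w (d :: r₂) →
      ∃ C', G.IsCycle C' ∧ ¬ G.Crosses o C' S ∧ length w C' ≤ length w L.flatten := by
    intro p hpw hpS hpl
    obtain ⟨C', h3, h4, h5⟩ := hS.exists_noncrossing hK (h1.append hpw) (.refl _) hp.ne_nil hQK
      (by
        have := (hf.map Prod.fst).nodup_iff.1 hnd
        rw [List.map_append] at this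
        exact this.of_append_left) hpS
    refine ⟨C', h3, h4, h5.trans ?_⟩
    rw [length_perm w hf, hr, length_append, length_append, length_append]
    gcongr
  rcases hp.start_mem with hx | hx
  · rcases hp.end_mem with hy | hy
    · exact hA hx hy
    · obtain ⟨p, hpw, hpS, -, -, hpl⟩ := hS.through x hx y hy hyz
      exact hfin p hpw hpS (hpl _ _ h2 h3)
  · rcases hp.end_mem with hy | hy
    · obtain ⟨p, hpw, hpS, -, -, hpl⟩ := hS.through y hy x hx hxz
      refine hfin _ hpw.reverseWalk (by rwa [edges_reverseWalk]) ?_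
      rw [length_reverseWalk, add_comm, ← length_reverseWalk w r₁, ← length_reverseWalk w (d :: r₂)]
      exact hpl _ _ h3.reverseWalk h2.reverseWalk
    · exact hB hx hy

/-! ### The winding argument -/

/-- The pieces on one side of `S`, each closed up through the common start of the two paths,
bound a function on the faces. -/
theorem exists_potential [Finite E] (hG : G.IsSphere) (hS : G.IsGeodesicCycle w o S A B z e b)
    (hK : K = G.interior o (edges S) ∨ K = (G.interior o (edges S))ᶜ) (s : ℝ)
    (hL : ∀ Q ∈ L, ((∀ d ∈ Q, G.Strict K d) ∧ ∃ x p, G.IsWalk x x (Q ++ p) ∧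
      edges p ⊆ edges S ∧ e.1 ∉ edges p ∧ flow p b = s) ∨ ∀ d ∈ Q, ¬ G.Strict K d) :
    ∃ (g : G.Face → ℝ) (n : ℕ),
      (∀ d, G.Strict K d → g (G.left d) - g (G.right d) = flow L.flatten d) ∧
      (∀ d : Dart E, ¬ G.Strict K d → d.1 ∉ edges S → g (G.left d) - g (G.right d) = 0) ∧
      g (G.left e) - g (G.right e) = 0 ∧ g (G.left b) - g (G.right b) = n * s ∧
      ∀ Q ∈ L, Q ≠ [] → (∀ d ∈ Q, G.Strict K d) → n ≠ 0 := by
  induction L with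
  | nil => exact ⟨0, 0, by simp [flow_nil], by simp, by simp, by simp, by simp⟩
  | cons Q L ih =>
    obtain ⟨g, n, h1, h2, h3, h4, h5⟩ := ih (fun Q' hQ' => hL Q' (List.mem_cons_of_mem _ hQ'))
    have hzero : ∀ d, (∀ d' ∈ Q, G.Strict K d' ↔ ¬ G.Strict K d) → flow Q d = 0 := by
      intro d hd
      apply flow_eq_zero
      rintro ⟨d', hd', he⟩
      rcases Dart.eq_or_eq_reverse he with rfl | rfl
      · have := hd _ hd'
        tauto
      · have := hd _ hd'
        rw [strict_reverse] at this
        tauto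
    rcases hL Q (by simp) with ⟨hQ, x, p, hw, hpS, hpe, hpb⟩ | hQ
    · obtain ⟨f, hf⟩ := hG.exists_potential hw
      have hSK : ∀ d : Dart E, d.1 ∈ edges S → ¬ G.Strict K d := fun d hd hs =>
        hS.not_mem_of_strict hK hs hd
      have hQ0 : ∀ d, ¬ G.Strict K d → flow Q d = 0 := fun d hd =>
        hzero d fun d' hd' => iff_of_true (hQ d' hd') hd
      -- `n` counts the closed-up pieces. Each contributes the same `s` at `b`, so nothing cancels.
      refine ⟨fun q => f q + g q, n + 1, fun d hd => ?_, fun d hd hdS => ?_, ?_, ?_, ?_⟩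
      · have hp0 : flow p d = 0 := flow_eq_zero fun h => hS.not_mem_of_strict hK hd (hpS h)
        rw [List.flatten_cons, flow_append, ← h1 d hd]
        linarith [hf d, flow_append Q p d]
      · have hp0 : flow p d = 0 := flow_eq_zero fun h => hdS (hpS h)
        linarith [hf d, flow_append Q p d, hQ0 d hd, h2 d hd hdS]
      · linarith [hf e, flow_append Q p e, hQ0 e (hSK e hS.e_mem), flow_eq_zero hpe]
      · push_cast
        linarith [hf b, flow_append Q p b, hQ0 b (hSK b hS.b_mem)]
      · intros; omega
    · refine ⟨g, n, fun d hd => ?_, h2, h3, h4, ?_⟩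
      · rw [List.flatten_cons, flow_append, h1 d hd,
          hzero d fun d' hd' => iff_of_false (hQ d' hd') (not_not.2 hd), zero_add]
      · intro Q' hQ' hne hK'
        rcases List.mem_cons.1 hQ' with rfl | hQ'
        · obtain ⟨a, ha⟩ := List.exists_mem_of_ne_nil _ hne
          exact absurd (hK' a ha) (hQ a ha)
        · exact h5 Q' hQ' hne hK'

/-- If all pieces on the side `K` run in the same direction, then the closed walk separates the
faces at `b` from the face at `e` that lies in `K`. -/
theorem false_of_same_direction [Finite E] (hG : G.IsSphere)
    (hS : G.IsGeodesicCycle w o S A B z e b)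
    (hK : K = G.interior o (edges S) ∨ K = (G.interior o (edges S))ᶜ)
    {s : ℝ} (hs : s ≠ 0)
    (hL : ∀ Q ∈ L, ((∀ d ∈ Q, G.Strict K d) ∧ ∃ x p, G.IsWalk x x (Q ++ p) ∧
      edges p ⊆ edges S ∧ e.1 ∉ edges p ∧ flow p b = s) ∨ ∀ d ∈ Q, ¬ G.Strict K d)
    {Q : List (Dart E)} (hQ : Q ∈ L) (hne : Q ≠ []) (hQK : ∀ d ∈ Q, G.Strict K d)
    {f : G.Face → ℝ} (hf : ∀ d, f (G.left d) - f (G.right d) = flow L.flatten d)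
    (hb : b.1 ∉ edges L.flatten) {v ve : G.Face} (hv : G.Incident v b.1)
    (hve : G.Incident ve e.1) (hveK : ve ∈ K) (hvv : f v = f ve) : False := by
  classical
  obtain ⟨g, n, h1, h2, h3, h4, h5⟩ := exists_potential hG hS hK s hL
  have hmem : ∀ {p q : G.Face}, (p ∈ K ↔ q ∈ K) →
      (p ∈ G.interior o (edges S) ↔ q ∈ G.interior o (edges S)) := by
    rcases hK with rfl | rfl
    · exact id
    · exact fun h => not_iff_not.1 h
  -- Inside `K`, `f` and `g` have equal jumps. Extending the difference by zero is harmless, as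
  -- Jordan's theorem for `S` allows any jump across `S`.
  have hin : ∀ p q, p ∈ K → q ∈ K → f p - g p = f q - g q := by
    intro p q hp hq
    have := hS.jordan (fun x => if x ∈ K then f x - g x else 0) (fun d hd => by
      have hlr := strict_of_not_mem hd hK
      by_cases h : G.left d ∈ K
      · have h' := hlr.1 h
        simp only [h, h', if_true]
        linarith [hf d, h1 d ⟨h, h'⟩]
      · have h' : G.right d ∉ K := fun hh => h (hlr.2 hh)
        simp only [h, h', if_false]) (hmem (iff_of_true hp hq))
    simpa [hp, hq] using this
  have hout : ∀ p q, p ∉ K → q ∉ K → g p = g q := by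
    intro p q hp hq
    have := hS.jordan (fun x => if x ∈ K then 0 else g x) (fun d hd => by
      have hlr := strict_of_not_mem hd hK
      by_cases h : G.left d ∈ K
      · have h' := hlr.1 h
        simp only [h, h', if_true]
      · have h' : G.right d ∉ K := fun hh => h (hlr.2 hh)
        simp only [h, h', if_false]
        linarith [h2 d (fun hh => h hh.1) hd]) (hmem (iff_of_false hp hq))
    simpa [hp, hq] using this
  have hside : ∀ d : Dart E, d.1 ∈ edges S → ∃ p q, p ∈ K ∧ q ∉ K ∧
      (p = G.left d ∧ q = G.right d ∨ p = G.right d ∧ q = G.left d) := by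
    intro d hd
    have h := hS.separates d hd
    have h' : G.left d ∈ K ↔ G.right d ∉ K := by
      rcases hK with rfl | rfl
      · exact h
      · simp only [Set.mem_compl_iff]; tauto
    by_cases hl : G.left d ∈ K
    · exact ⟨_, _, hl, h'.1 hl, .inl ⟨rfl, rfl⟩⟩
    · exact ⟨_, _, not_not.1 fun hr => hl (h'.2 hr), hl, .inr ⟨rfl, rfl⟩⟩
  obtain ⟨p, q, hp, hq, hpq⟩ := hside b hS.b_mem
  obtain ⟨p', q', hp', hq', hpq'⟩ := hside e hS.e_mem
  have hfb := hf b
  rw [flow_eq_zero hb] at hfb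
  have hve' : ve = p' := by
    rcases hve.eq_or with h | h <;> rcases hpq' with ⟨h3, h4⟩ | ⟨h3, h4⟩
    · rw [h, h3]
    · exact absurd (h4 ▸ h ▸ hveK) hq'
    · exact absurd (h4 ▸ h ▸ hveK) hq'
    · rw [h, h3]
  have hvp : f v = f p := by
    rcases hv.eq_or with h | h <;> rcases hpq with ⟨h3, h4⟩ | ⟨h3, h4⟩ <;> rw [h, h3] <;> linarith
  -- Go around: from `p` to `p'` within `K`, across `e` to `q'`, and outside `K` to `q`. `g` never
  -- changes, so it has no jump at `b`.
  have e1 := hin p p' hp hp'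
  have e2 := hout q q' hq hq'
  have e3 : g p' = g q' := by
    rcases hpq' with ⟨h, h'⟩ | ⟨h, h'⟩ <;> rw [h, h'] <;> linarith
  have e4 : g p = g q := by
    rw [hvp, hve'] at hvv
    linarith
  have e5 : (n : ℝ) * s = 0 := by
    rw [← h4]
    rcases hpq with ⟨h, h'⟩ | ⟨h, h'⟩ <;> rw [h, h'] at e4 <;> linarith
  exact (mul_ne_zero (Nat.cast_ne_zero.2 (h5 Q hQ hne hQK)) hs) e5

/-! ### Combining the exchanges -/

/-- A cycle that does not separate the faces at `b` from a face at `e` can be replaced by a cycle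
that does not cross `S` and is not longer. -/
theorem exists_shorter [Finite E] (hG : G.IsSphere) (hS : G.IsGeodesicCycle w o S A B z e b)
    {C : List (Dart E)} (hC : G.IsCycle C) {v ve : G.Face} (hv : G.Incident v b.1)
    (hve : G.Incident ve e.1) (hvC : v ∈ G.interior o (edges C))
    (hveC : ve ∈ G.interior o (edges C)) :
    ∃ C', G.IsCycle C' ∧ ¬ G.Crosses o C' S ∧ length w C' ≤ length w C := by
  classical
  by_contra hgood
  have hcross : G.Crosses o C S := by
    by_contra h
    exact hgood ⟨C, hC, h, le_rfl⟩
  obtain ⟨hne, ⟨u₀, hw₀⟩, ht, hnd⟩ := hC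
  -- the cycle meets `S`
  obtain ⟨d₀, hd₀, hd₀S⟩ : ∃ d ∈ C, G.tail d ∈ A ∪ B := by
    by_contra! h
    rcases hS.side_of_inner hw₀ (fun d hd => h d (List.mem_of_mem_tail hd)) with h' | h' | h'
    · exact hS.not_crosses (.inl rfl) (fun d hd => .inr (h' d hd)) hcross
    · exact hS.not_crosses (.inl rfl) (fun d hd => .inl (h' d hd)) hcross
    · exact hS.not_crosses (.inr rfl) (fun d hd => .inl (h' d hd)) hcross
  obtain ⟨c₁, c₂, rfl⟩ := List.append_of_mem hd₀
  have hperm : (c₁ ++ d₀ :: c₂).Perm (d₀ :: c₂ ++ c₁) := List.perm_append_comm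
  -- Starting the cycle at a vertex of `S` lets it be cut into pieces.
  have hw : G.IsWalk (G.tail d₀) (G.tail d₀) (d₀ :: c₂ ++ c₁) := by
    rw [isWalk_append] at hw₀
    obtain ⟨x, h1, h2⟩ := hw₀
    have hx : G.tail d₀ = x := h2.1
    rw [hx]
    exact h2.append h1
  obtain ⟨L, hLf, hL⟩ := IsWalk.exists_pieces _ le_rfl hw hd₀S hd₀S
  rw [← hLf] at hperm hw
  rw [length_perm w hperm] at hgood
  have hndL := (hperm.map Prod.fst).nodup_iff.1 hnd
  obtain ⟨f, hf⟩ := hG.exists_potential hw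
  have hfv : f v = f ve := by
    refine hG.eq_of_mem_interior_iff o ⟨hne, ⟨u₀, hw₀⟩, ht, hnd⟩ f (fun d hd => ?_)
      (iff_of_true hvC hveC)
    rw [edges_perm hperm] at hd
    linarith [hf d, flow_eq_zero hd]
  have hside : ∀ Q ∈ L, (∀ d ∈ Q, d.1 ∈ edges S) ∨
      (∀ d ∈ Q, G.Strict (G.interior o (edges S)) d) ∨
        (∀ d ∈ Q, G.Strict (G.interior o (edges S))ᶜ d) := by
    intro Q hQ
    obtain ⟨x, y, hp⟩ := hL Q hQ
    exact hS.side_of_inner hp.walk hp.inner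
  -- the side of `S` that contains `ve`
  obtain ⟨K, hK, hveK⟩ : ∃ K : Set G.Face, (K = G.interior o (edges S) ∨
      K = (G.interior o (edges S))ᶜ) ∧ ve ∈ K := by
    by_cases h : ve ∈ G.interior o (edges S)
    · exact ⟨_, .inl rfl, h⟩
    · exact ⟨_, .inr rfl, h⟩
  have hdich : ∀ Q ∈ L, (∀ d ∈ Q, G.Strict K d) ∨ ∀ d ∈ Q, ¬ G.Strict K d := by
    intro Q hQ
    rcases hside Q hQ with h | h | h
    · exact .inr fun d hd hs => hS.not_mem_of_strict hK hs (h d hd)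
    · rcases hK with rfl | rfl
      · exact .inl h
      · exact .inr fun d hd hs => hs.1 (h d hd).1
    · rcases hK with rfl | rfl
      · exact .inr fun d hd hs => (h d hd).1 hs.1
      · exact .inl h
  -- Without a piece in `K`, the cycle would stay in the closed other side.
  obtain ⟨Q, hQ, hQK⟩ : ∃ Q ∈ L, ∀ d ∈ Q, G.Strict K d := by
    by_contra! h
    refine hS.not_crosses (K := Kᶜ) (by rcases hK with rfl | rfl <;> simp) (fun d hd => ?_) hcross
    obtain ⟨Q, hQ, hdQ⟩ := List.mem_flatten.1 (hperm.mem_iff.1 hd)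
    by_cases hdS : d.1 ∈ edges S
    · exact .inr hdS
    · left
      obtain ⟨d', hd', hd's⟩ := h Q hQ
      have hd := (hdich Q hQ).resolve_left (fun h' => hd's (h' d' hd')) d hdQ
      have hlr := strict_of_not_mem hdS hK
      exact ⟨fun hl => hd ⟨hl, hlr.1 hl⟩, fun hr => hd ⟨hlr.2 hr, hr⟩⟩
  have hdir : ∀ Q ∈ L, (∀ d ∈ Q, G.Strict K d) → ∀ x y, G.IsPiece (A ∪ B) x y Q →
      (x ∈ A ∧ x ∉ B ∧ y ∈ B ∧ y ∉ A) ∨ (x ∈ B ∧ x ∉ A ∧ y ∈ A ∧ y ∉ B) := by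
    intro Q hQ hQK x y hp
    have hA : x ∈ A → y ∉ A := fun hx hy =>
      hgood (hS.exists_of_same_path hK hw hndL hQ hQK hp (.inl rfl) hx hy)
    have hB : x ∈ B → y ∉ B := fun hx hy =>
      hgood (hS.exists_of_same_path hK hw hndL hQ hQK hp (.inr rfl) hx hy)
    have := hp.start_mem
    have := hp.end_mem
    simp only [Set.mem_union] at *
    tauto
  obtain ⟨x, y, hp⟩ := hL Q hQ
  -- Using `b` in either direction means visiting `z`.
  have hb : b.1 ∉ edges L.flatten := by
    rintro ⟨d, hd, he⟩
    rcases Dart.eq_or_eq_reverse he with rfl | rfl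
    · exact hgood (hS.exists_of_apex hK hw hndL hQ hQK hp hd hS.tail_b)
    · obtain ⟨d', hd', hdd⟩ := hw.head_mem hd
      rw [head_reverse, hS.tail_b] at hdd
      exact hgood (hS.exists_of_apex hK hw hndL hQ hQK hp hd' hdd)
  rcases hdir Q hQ hQK x y hp with ⟨hx, hxB, hy, hyA⟩ | ⟨hx, hxA, hy, hyB⟩
  -- Pieces from `A` to `B` are closed by a path from `B` to `A`, which runs along `b` backwards; in
  -- the other case the sign flips.
  · refine hS.false_of_same_direction hG hK (s := -1) (by norm_num) (fun Q' hQ' => ?_) hQ hp.ne_nil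
      hQK hf hb hv hve hveK hfv
    refine (hdich Q' hQ').imp (fun hQK' => ⟨hQK', ?_⟩) id
    obtain ⟨x', y', hp'⟩ := hL Q' hQ'
    rcases hdir Q' hQ' hQK' x' y' hp' with ⟨hx', hxB', hy', hyA'⟩ | ⟨hx', hxA', hy', hyB'⟩
    · obtain ⟨p, hpw, hpS, hpe, hpb, -⟩ := hS.through x' hx' y' hy'
        (fun h => hyA' (h ▸ hS.apex_left))
      exact ⟨x', p, hp'.walk.append hpw, hpS, hpe, hpb⟩
    · exact absurd (hS.exists_of_opposite hK hw hndL hQ hQK hQ' hQK' hp hp' hx hxB hy hx' hy') hgood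
  · refine hS.false_of_same_direction hG hK (s := 1) (by norm_num) (fun Q' hQ' => ?_) hQ hp.ne_nil
      hQK hf hb hv hve hveK hfv
    refine (hdich Q' hQ').imp (fun hQK' => ⟨hQK', ?_⟩) id
    obtain ⟨x', y', hp'⟩ := hL Q' hQ'
    rcases hdir Q' hQ' hQK' x' y' hp' with ⟨hx', hxB', hy', hyA'⟩ | ⟨hx', hxA', hy', hyB'⟩
    · exact absurd (hS.exists_of_opposite hK hw hndL hQ' hQK' hQ hQK hp' hp hx' hxB' hy' hx hy) hgood
    · obtain ⟨p, hpw, hpS, hpe, hpb, -⟩ := hS.through y' hy' x' hx'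
        (fun h => hxA' (h ▸ hS.apex_left))
      refine ⟨x', _, hp'.walk.append hpw.reverseWalk, by rwa [edges_reverseWalk],
        by rwa [edges_reverseWalk], ?_⟩
      rw [flow_reverseWalk, hpb, neg_neg]

end IsGeodesicCycle

end EmbeddedGraph
-- Fundamental cycles of shortest-path trees
namespace EmbeddedGraph

variable {E : Type*}

/-- The vertices of the walk `P` that starts at `z`. -/
def support (G : EmbeddedGraph E) (z : G.Vertex) (P : List (Dart E)) : Set G.Vertex :=
  {x | ∃ l₁ l₂, P = l₁ ++ l₂ ∧ G.IsWalk z x l₁}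

theorem start_mem_support (G : EmbeddedGraph E) (z : G.Vertex) (P : List (Dart E)) :
    z ∈ G.support z P := ⟨[], P, rfl, rfl⟩

theorem IsWalk.tail_mem_support {G : EmbeddedGraph E} {z t : G.Vertex} {P : List (Dart E)}
    (h : G.IsWalk z t P) {d : Dart E} (hd : d ∈ P) :
    G.tail d ∈ G.support z P ∧ G.head d ∈ G.support z P := by
  obtain ⟨l₁, l₂, rfl⟩ := List.append_of_mem hd
  rw [isWalk_append] at h
  obtain ⟨x, h1, h2⟩ := h
  obtain rfl : G.tail d = x := h2.1
  exact ⟨⟨l₁, _, rfl, h1⟩, ⟨l₁ ++ [d], l₂, by simp, h1.append ⟨rfl, rfl⟩⟩⟩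

theorem IsWalk.end_mem_support {G : EmbeddedGraph E} {z t : G.Vertex} {P : List (Dart E)}
    (h : G.IsWalk z t P) : t ∈ G.support z P := ⟨P, [], by simp, h⟩

theorem IsWalk.exists_between {G : EmbeddedGraph E} {z x y : G.Vertex} {P : List (Dart E)}
    (hx : x ∈ G.support z P) (hy : y ∈ G.support z P) :
    (∃ l₁ l₂ l₃, P = l₁ ++ l₂ ++ l₃ ∧ G.IsWalk z x l₁ ∧ G.IsWalk x y l₂) ∨
      ∃ l₁ l₂ l₃, P = l₁ ++ l₂ ++ l₃ ∧ G.IsWalk z y l₁ ∧ G.IsWalk y x l₂ := by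
  obtain ⟨l₁, l₂, rfl, h1⟩ := hx
  obtain ⟨m₁, m₂, he, h2⟩ := hy
  rcases List.append_eq_append_iff.1 he with ⟨k, rfl, rfl⟩ | ⟨k, rfl, rfl⟩
  · left
    obtain ⟨x', h3, h4⟩ := isWalk_append.1 h2
    obtain rfl := h1.unique h3
    exact ⟨l₁, k, m₂, by simp, h1, h4⟩
  · right
    obtain ⟨x', h3, h4⟩ := isWalk_append.1 h1
    obtain rfl := h2.unique h3
    exact ⟨m₁, k, l₂, rfl, h2, h4⟩

/-- A subpath of a path of a shortest-path tree that starts at the root is a shortest walk. -/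
theorem IsShortestPathTree.length_le {G : EmbeddedGraph E} {w : E → ℝ≥0∞} {r : G.Vertex}
    {T : Set E} (hT : G.IsShortestPathTree w r T) {p l m : List (Dart E)} {x y t : G.Vertex}
    (hp : G.IsPath r t (p ++ l ++ m)) (hpT : edges (p ++ l ++ m) ⊆ T) (hx : G.IsWalk r x p)
    (hy : G.IsWalk x y l) {q : List (Dart E)} (hq : G.IsWalk x y q) :
    length w l ≤ length w q := by
  have hpT' : edges (p ++ l) ⊆ T := by
    rw [edges_append] at hpT
    exact Set.subset_union_left.trans hpT
  have h := hT.2.2 y (p ++ l) (p ++ q) ⟨hx.append hy, by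
    refine hp.2.sublist (List.Sublist.cons_cons _ (List.Sublist.map _ ?_))
    exact List.sublist_append_left _ _⟩ hpT' (hx.append hq)
  rw [length_append, length_append] at h
  -- Cancelling the common initial path from the root needs its length to be finite; this is where
  -- finite tree weights enter.
  refine (ENNReal.add_le_add_iff_left ?_).1 h
  rw [edges_append] at hpT'
  clear h hp hx hpT
  induction p with
  | nil => simp [length]
  | cons a p ih =>
    rw [← List.singleton_append, length_append]
    refine ENNReal.add_ne_top.2 ⟨?_, ih fun x hx => hpT' (hx.imp (fun ⟨d, hd, h⟩ =>
      ⟨d, List.mem_cons_of_mem _ hd, h⟩) id)⟩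
    simpa [length] using hT.2.1 a.1 (hpT' (.inl ⟨a, by simp, rfl⟩))

theorem IsShortestPathTree.exists_geodesic {G : EmbeddedGraph E} {w : E → ℝ≥0∞} {r : G.Vertex}
    {T : Set E} (hT : G.IsShortestPathTree w r T) {P₀ P : List (Dart E)} {z t : G.Vertex}
    (hp : G.IsPath r t (P₀ ++ P)) (hpT : edges (P₀ ++ P) ⊆ T) (hz : G.IsWalk r z P₀)
    {x y : G.Vertex} (hx : x ∈ G.support z P) (hy : y ∈ G.support z P) :
    ∃ p, G.IsWalk x y p ∧ edges p ⊆ edges P ∧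
      ∀ q, G.IsWalk x y q → length w p ≤ length w q := by
  rcases IsWalk.exists_between hx hy with ⟨l₁, l₂, l₃, rfl, h1, h2⟩ | ⟨l₁, l₂, l₃, rfl, h1, h2⟩
  · refine ⟨l₂, h2, ?_, fun q hq => ?_⟩
    · rw [edges_append, edges_append]
      exact Set.subset_union_right.trans Set.subset_union_left
    · simp only [← List.append_assoc] at hp hpT
      exact hT.length_le hp hpT (hz.append h1) h2 hq
  · refine ⟨reverseWalk l₂, h2.reverseWalk, ?_, fun q hq => ?_⟩
    · rw [edges_reverseWalk, edges_append, edges_append]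
      exact Set.subset_union_right.trans Set.subset_union_left
    · simp only [← List.append_assoc] at hp hpT
      rw [length_reverseWalk, ← length_reverseWalk w q]
      exact hT.length_le hp hpT (hz.append h1) h2 hq.reverseWalk

theorem edges_separator (Pa Pb : List (Dart E)) (e : Dart E) :
    edges (separator Pa e Pb) = edges Pa ∪ ({e.1} ∪ edges Pb) := by
  have h : separator Pa e Pb = Pa ++ ([e] ++ reverseWalk Pb) := rfl
  rw [h, edges_append, edges_append, edges_reverseWalk]
  congr 2
  ext x
  simp [edges, eq_comm]

/-- Stretches of root paths are shortest walks. The path joining the two sides through `z` is a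
concatenation of two such stretches. -/
theorem IsTreeSeparator.isGeodesicCycle [Finite E] {G : EmbeddedGraph E} (hG : G.IsSphere)
    (o : G.Face) {w : E → ℝ≥0∞} {r : G.Vertex} {T : Set E} (hT : G.IsShortestPathTree w r T)
    {Pa Pb : List (Dart E)} {e b : Dart E} (hS : G.IsTreeSeparator r T Pa e (b :: Pb)) :
    ∃ A B z, G.IsGeodesicCycle w o (separator Pa e (b :: Pb)) A B z e b := by
  obtain ⟨heT, ⟨P₀, ⟨hpa, hpaT⟩, ⟨hpb, hpbT⟩⟩, hcyc⟩ := hS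
  obtain ⟨z, hz, hza⟩ := isWalk_append.1 hpa.1
  obtain ⟨z', hz', hzb⟩ := isWalk_append.1 hpb.1
  obtain rfl := hz.unique hz'
  have hes := edges_separator Pa (b :: Pb) e
  have hnd := hcyc.2.2.2
  have hsa : edges Pa ⊆ edges (separator Pa e (b :: Pb)) := by
    rw [hes]; exact Set.subset_union_left
  have hsb : edges (b :: Pb) ⊆ edges (separator Pa e (b :: Pb)) := by
    rw [hes]; exact Set.subset_union_right.trans Set.subset_union_right
  have haT : edges Pa ⊆ T := by
    rw [edges_append] at hpaT; exact Set.subset_union_right.trans hpaT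
  have hbT : edges (b :: Pb) ⊆ T := by
    rw [edges_append] at hpbT; exact Set.subset_union_right.trans hpbT
  obtain ⟨f, hf⟩ : ∃ f : G.Face → ℝ, ∀ d, f (G.left d) - f (G.right d) =
      flow (separator Pa e (b :: Pb)) d := hG.exists_potential hcyc.2.1.choose_spec
  have hnd' : (Pa.map Prod.fst ++ e.1 :: ((b :: Pb).map Prod.fst).reverse).Nodup := by
    have : (separator Pa e (b :: Pb)).map Prod.fst =
        Pa.map Prod.fst ++ e.1 :: ((b :: Pb).map Prod.fst).reverse := by
      simp [separator, reverseWalk, Function.comp_def, Dart.reverse]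
    rwa [← this]
  have hjordan := fun (g : G.Face → ℝ) hg {p q : G.Face} h =>
    hG.eq_of_mem_interior_iff o hcyc g hg (p := p) (q := q) h
  refine ⟨G.support z Pa, G.support z (b :: Pb), z, ?_⟩
  refine
    { separates := ?_
      jordan := hjordan
      tail_mem := ?_
      left_geodesic := ?_
      right_geodesic := ?_
      through := ?_
      apex_left := G.start_mem_support _ _
      apex_right := G.start_mem_support _ _
      tail_b := hzb.1
      b_mem := hsb ⟨b, by simp, rfl⟩
      e_mem := by rw [hes]; simp }
  · rintro d ⟨d', hd', he⟩
    -- The winding function of `S` jumps by one across each of its edges, whereas Jordan's theorem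
    -- would make it equal on faces of the same side.
    have hne : f (G.left d) ≠ f (G.right d) := by
      have h1 := hf d'
      rw [flow_eq_one hd' hnd] at h1
      intro h
      rcases Dart.eq_or_eq_reverse he with rfl | rfl
      · linarith
      · rw [right_reverse] at h1
        change f (G.right d) - _ = _ at h1
        linarith
    by_contra hcon
    refine hne (hjordan f (fun c hc => ?_) (by tauto))
    linarith [hf c, flow_eq_zero hc]
  · intro d hd
    rw [hes] at hd
    have hend : ∀ d' : Dart E, d'.1 = d.1 → (G.tail d' ∈ G.support z Pa ∪ G.support z (b :: Pb) ∧
        G.head d' ∈ G.support z Pa ∪ G.support z (b :: Pb)) →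
        G.tail d ∈ G.support z Pa ∪ G.support z (b :: Pb) := by
      intro d' he h
      rcases Dart.eq_or_eq_reverse he with rfl | rfl
      · exact h.1
      · rw [head_reverse] at h
        exact h.2
    rcases hd with ⟨d', hd', he⟩ | he | ⟨d', hd', he⟩
    · exact hend d' he ((hza.tail_mem_support hd').imp .inl .inl)
    · exact hend e he.symm ⟨.inl hza.end_mem_support, .inr hzb.end_mem_support⟩
    · exact hend d' he ((hzb.tail_mem_support hd').imp .inr .inr)
  · intro x hx y hy
    obtain ⟨p, h1, h2, h3⟩ := hT.exists_geodesic hpa hpaT hz hx hy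
    exact ⟨p, h1, h2.trans hsa, h3⟩
  · intro x hx y hy
    obtain ⟨p, h1, h2, h3⟩ := hT.exists_geodesic hpb hpbT hz hx hy
    exact ⟨p, h1, h2.trans hsb, h3⟩
  · rintro x ⟨m₁, m₂, hm, hx⟩ y ⟨l₁, l₂, hl, hy⟩ hyz
    have hm1 : edges m₁ ⊆ edges Pa := by
      rw [hm, edges_append]; exact Set.subset_union_left
    have hl1 : edges l₁ ⊆ edges (b :: Pb) := by
      rw [hl, edges_append]; exact Set.subset_union_left
    refine ⟨reverseWalk l₁ ++ m₁, hy.reverseWalk.append hx, ?_, ?_, ?_, ?_⟩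
    · rw [edges_append, edges_reverseWalk]
      exact Set.union_subset (hl1.trans hsb) (hm1.trans hsa)
    · rw [edges_append, edges_reverseWalk]
      rintro (h | h)
      · exact heT (hbT (hl1 h))
      · exact heT (haT (hm1 h))
    -- Since `y ≠ z`, the stretch from `z` to `y` is nonempty and begins with `b`.
    · have hb1 : b ∈ l₁ := by
        cases l₁ with
        | nil => exact absurd (Eq.symm hy) hyz
        | cons a l =>
          rw [List.cons_append, List.cons.injEq] at hl
          simp [hl.1]
      have hnb : ((b :: Pb).map Prod.fst).Nodup :=
        List.nodup_reverse.1 (List.nodup_cons.1 hnd'.of_append_right).2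
      have hnl : (l₁.map Prod.fst).Nodup := by
        rw [hl, List.map_append] at hnb
        exact hnb.of_append_left
      have hbm : b.1 ∉ edges m₁ := by
        intro h
        obtain ⟨d, hd, he⟩ := hm1 h
        exact List.disjoint_of_nodup_append hnd' (List.mem_map.2 ⟨d, hd, he⟩) (by simp)
      rw [flow_append, flow_reverseWalk, flow_eq_one hb1 hnl, flow_eq_zero hbm, add_zero]
    · intro q q' hq hq'
      rw [length_append, length_reverseWalk, ← length_reverseWalk w q]
      refine add_le_add ?_ ?_
      · rw [hl, ← List.append_assoc] at hpb hpbT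
        exact hT.length_le hpb hpbT hz hy hq.reverseWalk
      · rw [hm, ← List.append_assoc] at hpa hpaT
        exact hT.length_le hpa hpaT hz hx hq'

end EmbeddedGraph

theorem mainTheorem3 {E : Type*} [Finite E] (G : EmbeddedGraph E) (hG : G.IsPlanar)
    (o : G.dual.Face) (w : E → ℝ≥0∞)
    (r : G.dual.Vertex) (T : Set E) (hT : G.dual.IsShortestPathTree w r T)
    (Pa : List (Dart E)) (e : Dart E) (b : Dart E) (Pb : List (Dart E))
    (hS : G.dual.IsTreeSeparator r T Pa e (b :: Pb))
    (ve : G.dual.Face) (hve : G.dual.Incident ve e.1)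
    (v : G.dual.Face) (hv : G.dual.Incident v b.1)
    (hvS : v ∉ G.dual.interior o (EmbeddedGraph.edges (EmbeddedGraph.separator Pa e (b :: Pb))))
    (C : List (Dart E)) (hC : G.dual.IsCycle C)
    (hCv : v ∈ G.dual.interior o (EmbeddedGraph.edges C))
    (hCve : ve ∈ G.dual.interior o (EmbeddedGraph.edges C)) :
    ∃ C' : List (Dart E), G.dual.IsCycle C' ∧
      ¬ G.dual.Crosses o C' (EmbeddedGraph.separator Pa e (b :: Pb)) ∧
      EmbeddedGraph.length w C' ≤ EmbeddedGraph.length w C := by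
  obtain ⟨A, B, z, hA⟩ := hS.isGeodesicCycle hG.dual_isSphere o hT
  exact hA.exists_shorter hG.dual_isSphere hC hv hve hCv hCve
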